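/- For $\zeta>0$ let $K_\pm(\zeta)$ be the integral operators on $L^2(-1,1)$ with the kernels $$k_\pm(x,t,\zeta)=\frac12\left[\frac{\sin \zeta\pi(x-t)}{\pi(x-t)}\pm\frac{\sin \zeta\pi(x+t)}{\pi(x+t)}\right]$$ (where $\frac{\sin\zeta\pi u}{\pi u}$ means $\zeta$ at $u=0$), and let $P_\pm(\zeta,1)=\det(I-K_\pm(\zeta))$ be their Fredholm determinants, i.e. the sums of the Fredholm series $$\sum_{n\ge 0}\frac{(-1)^n}{n!}\int_{[-1,1]^n}\det\big[k_\pm(x_i,x_j,\zeta)\big]_{i,j=1}^n\,dx_1\cdots dx_n .$$ Let $C_\zeta f(x)=\int_{-\zeta}^{\zeta}\frac{\sin\pi(x-y)}{\pi(x-y)}f(y)\,dy$ on $L^2(-\zeta,\zeta)$. Then, for every $\zeta>0$, there is a continuous kernel $Q_\zeta$ on $[-\zeta,\zeta]^2$ such that $f\mapsto f+\int_{-\zeta}^{\zeta}Q_\zeta(\cdot,y)f(y)\,dy$ is the two-sided inverse of $I-C_\zeta$ on $L^2(-\zeta,\zeta)$ (this kernel is unique); put $$r(\zeta)=e^{i\zeta\pi}+\int_{-\zeta}^{\zeta}Q_\zeta(-\zeta,s)\,e^{-is\pi}\,ds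 .$$ Then for every $\zeta>0$ the Fredholm series converge absolutely, $P_\pm(\zeta,1)>0$, the function $r^2$ is integrable on $(0,\zeta)$, the functions $\log P_\pm(\cdot,1)$ are differentiable at $\zeta$, and $$\zeta\frac{d}{d\zeta}\log P_\pm(\zeta,1)=-\left\{\int_0^\zeta|r^2(s)|\,ds\pm\operatorname{Re}\int_0^\zeta r^2(s)\,ds\right\},$$ with the same choice of sign on both sides. -/

import Mathlib

open MeasureTheory Set

noncomputable section

namespace SineDet

/-- The continuous function `u ↦ sin (ζ π u) / (π u)`, with its value `ζ` at `u = 0`. -/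
def sineFun (ζ u : ℝ) : ℝ := ζ * Real.sinc (ζ * Real.pi * u)

theorem sineFun_of_ne_zero (ζ : ℝ) {u : ℝ} (hu : u ≠ 0) :
    sineFun ζ u = Real.sin (ζ * Real.pi * u) / (Real.pi * u) := by
  have hp := Real.pi_ne_zero
  by_cases h : ζ = 0
  · simp [sineFun, h]
  · have h' : ζ * Real.pi * u ≠ 0 := mul_ne_zero (mul_ne_zero h hp) hu
    rw [sineFun, Real.sinc_of_ne_zero h']
    field_simp

theorem sineFun_zero (ζ : ℝ) : sineFun ζ 0 = ζ := by simp [sineFun]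

/-- The kernel `k_±(x,t,ζ)` of `K_±(ζ)`; the sign `±` is the number `ε = ± 1`. -/
def kPM (ε ζ x t : ℝ) : ℝ := (sineFun ζ (x - t) + ε * sineFun ζ (x + t)) / 2

/-- The `n`-th term of the Fredholm series of `det (I - lam K)`, where `K` is the integral operator
on `L²(a,b)` with the continuous kernel `k`. -/
def fredholmTerm (k : ℝ → ℝ → ℝ) (a b lam : ℝ) (n : ℕ) : ℝ :=
  (-lam) ^ n / (n.factorial : ℝ) *
    ∫ x in Set.pi univ (fun _ : Fin n => Icc a b),
      (Matrix.of (fun i j : Fin n => k (x i) (x j))).det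

/-- The Fredholm determinant `det (I - lam K)`, `K` as above. -/
def fredholmDet (k : ℝ → ℝ → ℝ) (a b lam : ℝ) : ℝ := ∑' n : ℕ, fredholmTerm k a b lam n

/-- `P_±(ζ,lam) = det (I - lam K_±(ζ))`, with `K_±(ζ)` on `L²(-1,1)` and `ε = ± 1`. -/
def P (ε ζ lam : ℝ) : ℝ := fredholmDet (kPM ε ζ) (-1) 1 lam

/-- The integral operator on the interval `(-ζ,ζ)` with real kernel `k`. -/
def intOp (ζ : ℝ) (k : ℝ → ℝ → ℝ) (f : ℝ → ℂ) (x : ℝ) : ℂ :=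
  ∫ t in (-ζ)..ζ, (k x t : ℂ) * f t

/-- `q` is the resolvent kernel of the operator `C f (x) = ∫_{-ζ}^{ζ} k (x,t) f (t) dt`:
it is continuous on `[-ζ,ζ]²`, and the operator `f ↦ f + ∫ q (·,t) f (t) dt` is the two-sided
inverse of `I - C` on the complex space `L²(-ζ,ζ)`. -/
def IsResolventKernel (ζ : ℝ) (k q : ℝ → ℝ → ℝ) : Prop :=
  ContinuousOn (fun p : ℝ × ℝ => q p.1 p.2) (Icc (-ζ) ζ ×ˢ Icc (-ζ) ζ) ∧
  ∀ f : ℝ → ℂ, MemLp f 2 (volume.restrict (Ioc (-ζ) ζ)) →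
    ((fun x => (f x + intOp ζ q f x) - intOp ζ k (fun y => f y + intOp ζ q f y) x)
      =ᵐ[volume.restrict (Ioc (-ζ) ζ)] f) ∧
    ((fun x => (f x - intOp ζ k f x) + intOp ζ q (fun y => f y - intOp ζ k f y) x)
      =ᵐ[volume.restrict (Ioc (-ζ) ζ)] f)

/-- The kernel `sin (π (x - t)) / (π (x - t))`. -/
def sineKernel (x t : ℝ) : ℝ := sineFun 1 (x - t)

open Classical in
/-- `Q_ζ (x,t)`, the resolvent kernel of the sine kernel operator on `(-ζ,ζ)` (by continuity it is
determined on `[-ζ,ζ]²`; the values elsewhere play no role). -/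
def Q (ζ : ℝ) : ℝ → ℝ → ℝ :=
  if h : ∃ q : ℝ → ℝ → ℝ, IsResolventKernel ζ sineKernel q then h.choose else 0

/-- `r(ζ) = e^{iζπ} + ∫_{-ζ}^{ζ} Q_ζ(-ζ,s) e^{-isπ} ds`. -/
def r (ζ : ℝ) : ℂ :=
  Complex.exp (Complex.I * ζ * Real.pi) +
    ∫ s in (-ζ)..ζ, (Q ζ (-ζ) s : ℂ) * Complex.exp (-(Complex.I * s * Real.pi))

end SineDet

end

/-!
The `z`-derivative of the kernel `kPM ε z` has rank one: it is `φ z x * φ z t`, with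
`φ z x = cos (π z x)` or `sin (π z x)`. Hence `d/dz log P ε z 1 = -⟨(1 - K z)⁻¹ (φ z), φ z⟩`.
Scaling `[-1, 1]` to `[-z, z]` makes both the kernel and the right-hand side of the equation for
`(1 - K z)⁻¹ (φ z)` independent of `z`, so that `z` enters only through the interval. Since the
kernel is symmetric, the derivative of `z * ⟨(1 - K z)⁻¹ (φ z), φ z⟩` is then the sum of the squares
of the solution at the two endpoints. On even and odd functions `kPM ε z` acts as the sine kernel,
so the two solutions combine to the solution for `exp (-i π x)`, whose value at `-z` is `r z`; the
endpoint values are thus the real and imaginary part of `r z`.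

The operators `1 - K z` are invertible because `K z` is compact and has no eigenvalue `1`: by
Plancherel's theorem the Fourier transform of a fixed point vanishes outside a bounded interval,
and it is an entire function since the fixed point lives on a bounded interval.
-/

noncomputable section

namespace SineDet

section KernelOperator

theorem isCompact_closure_of_equicontinuous {X : Type*} [TopologicalSpace X] [CompactSpace X]
    {S : Set C(X, ℝ)} {C : ℝ} (hbound : ∀ f ∈ S, ‖f‖ ≤ C)
    (hequi : Equicontinuous ((↑) : S → X → ℝ)) : IsCompact (closure S) := by
  let e := ContinuousMap.isometryEquivBoundedOfCompact X ℝ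
  have hcompact : IsCompact (closure (e '' S)) := by
    refine BoundedContinuousFunction.arzela_ascoli (Metric.closedBall 0 C)
      (isCompact_closedBall _ _) _ ?_ ?_
    · rintro _ x ⟨f, hf, rfl⟩
      exact mem_closedBall_zero_iff.2 ((f.norm_coe_le_norm x).trans (hbound f hf))
    · intro x V hV
      filter_upwards [hequi x V hV] with y hy
      rintro ⟨_, f, hf, rfl⟩
      exact hy ⟨f, hf⟩
  have himage := e.toHomeomorph.image_closure S
  rw [show closure (e '' S) = e '' closure S from himage.symm] at hcompact
  exact e.toHomeomorph.isCompact_image.1 hcompact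

variable {X : Type*} [TopologicalSpace X] [CompactSpace X] [MeasurableSpace X]

theorem abs_integral_mul_le (μ : Measure X) [IsFiniteMeasure μ] (h f : C(X, ℝ)) :
    |∫ t, h t * f t ∂μ| ≤ μ.real univ * ‖h‖ * ‖f‖ := by
  have hbound := norm_integral_le_of_norm_le_const (μ := μ) (f := fun t => h t * f t)
    (Filter.Eventually.of_forall fun t => (norm_mul_le (h t) (f t)).trans
      (mul_le_mul (h.norm_coe_le_norm t) (f.norm_coe_le_norm t) (norm_nonneg _) (norm_nonneg _)))
  rw [Real.norm_eq_abs] at hbound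
  linarith

variable [OpensMeasurableSpace X] (μ : Measure X) [IsFiniteMeasure μ]

theorem integrable_of_continuous {f : X → ℝ} (hf : Continuous f) : Integrable f μ :=
  hf.integrable_of_hasCompactSupport (HasCompactSupport.of_compactSpace _)

theorem integral_sub_mul (h h' f : C(X, ℝ)) :
    ∫ t, (h - h') t * f t ∂μ = (∫ t, h t * f t ∂μ) - ∫ t, h' t * f t ∂μ := by
  simp only [ContinuousMap.sub_apply, sub_mul]
  exact integral_sub (integrable_of_continuous μ (by fun_prop))
    (integrable_of_continuous μ (by fun_prop))

theorem dist_integral_mul_le (h h' f : C(X, ℝ)) :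
    dist (∫ t, h t * f t ∂μ) (∫ t, h' t * f t ∂μ) ≤ μ.real univ * dist h h' * ‖f‖ := by
  rw [Real.dist_eq, ← integral_sub_mul, dist_eq_norm]
  exact abs_integral_mul_le μ (h - h') f

theorem continuous_integral_curry_mul (k : C(X × X, ℝ)) (f : C(X, ℝ)) :
    Continuous fun x => ∫ t, k (x, t) * f t ∂μ := by
  have hcont : Continuous fun x => k.curry x := k.curry.continuous
  refine continuous_iff_continuousAt.2 fun x => tendsto_iff_dist_tendsto_zero.2 ?_
  refine squeeze_zero (fun _ => dist_nonneg)
    (fun y => dist_integral_mul_le μ (k.curry y) (k.curry x) f) ?_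
  have : Continuous fun y => μ.real univ * dist (k.curry y) (k.curry x) * ‖f‖ := by fun_prop
  simpa using this.tendsto x

/-- The integral operator with kernel `k` on the space of continuous functions, as a bounded
bilinear map of the kernel and the function it acts on. -/
def kernelOp : C(X × X, ℝ) →L[ℝ] C(X, ℝ) →L[ℝ] C(X, ℝ) :=
  LinearMap.mkContinuous₂
    (LinearMap.mk₂ ℝ
      (fun k f => ⟨fun x => ∫ t, k (x, t) * f t ∂μ, continuous_integral_curry_mul μ k f⟩)
      (fun k l f => by
        ext x
        simp only [ContinuousMap.coe_mk, ContinuousMap.add_apply, add_mul]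
        exact integral_add (integrable_of_continuous μ (by fun_prop))
          (integrable_of_continuous μ (by fun_prop)))
      (fun c k f => by
        ext x
        simp [mul_assoc, integral_const_mul])
      (fun k f g => by
        ext x
        simp only [ContinuousMap.coe_mk, ContinuousMap.add_apply, mul_add]
        exact integral_add (integrable_of_continuous μ (by fun_prop))
          (integrable_of_continuous μ (by fun_prop)))
      (fun c k f => by
        ext x
        simp [mul_left_comm _ c, integral_const_mul]))
    (μ.real univ) (fun k f => by
      rw [LinearMap.mk₂_apply, ContinuousMap.norm_le _ (by positivity)]
      intro x
      refine (abs_integral_mul_le μ (k.curry x) f).trans ?_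
      gcongr
      exact (ContinuousMap.norm_le _ (norm_nonneg k)).2 fun t => k.norm_coe_le_norm (x, t))

theorem kernelOp_apply (k : C(X × X, ℝ)) (f : C(X, ℝ)) (x : X) :
    kernelOp μ k f x = ∫ t, k (x, t) * f t ∂μ := rfl

theorem equicontinuous_kernelOp (k : C(X × X, ℝ)) :
    Equicontinuous ((↑) : kernelOp μ k '' Metric.closedBall 0 1 → X → ℝ) := by
  intro x
  rw [Metric.equicontinuousAt_iff_right]
  intro δ hδ
  have hcurry : Continuous fun y => k.curry y := k.curry.continuous
  have hlim : Filter.Tendsto (fun y => μ.real univ * dist (k.curry x) (k.curry y)) (nhds x)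
      (nhds 0) := by
    have : Continuous fun y => μ.real univ * dist (k.curry x) (k.curry y) := by fun_prop
    simpa using this.tendsto x
  filter_upwards [hlim.eventually (gt_mem_nhds hδ)] with y hy
  rintro ⟨_, f, hf, rfl⟩
  exact ((dist_integral_mul_le μ (k.curry x) (k.curry y) f).trans
    (mul_le_of_le_one_right (by positivity) (mem_closedBall_zero_iff.1 hf))).trans_lt hy

theorem isCompactOperator_kernelOp (k : C(X × X, ℝ)) : IsCompactOperator (kernelOp μ k) := by
  refine (isCompactOperator_iff_isCompact_closure_image_closedBall (kernelOp μ k).toLinearMap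
    one_pos).2 (isCompact_closure_of_equicontinuous (C := ‖kernelOp μ k‖) ?_
    (equicontinuous_kernelOp μ k))
  rintro _ ⟨f, hf, rfl⟩
  exact (kernelOp μ k).unit_le_opNorm f (mem_closedBall_zero_iff.1 hf)

theorem isUnit_one_sub_kernelOp (k : C(X × X, ℝ))
    (hk : ∀ f : C(X, ℝ), kernelOp μ k f = f → f = 0) : IsUnit (1 - kernelOp μ k) := by
  rcases (isCompactOperator_kernelOp μ k).hasEigenvalue_or_mem_resolventSet (one_ne_zero (α := ℝ))
    with heigen | hresolvent
  · obtain ⟨f, hf⟩ := heigen.exists_hasEigenvector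
    exact absurd (hk f (by simpa using hf.apply_eq_smul)) hf.2
  · simpa [spectrum.mem_resolventSet_iff] using hresolvent

theorem exists_continuousMap_solution {Z : Type*} [TopologicalSpace Z] (k : C(Z, C(X × X, ℝ)))
    (φ : C(Z, C(X, ℝ))) (hk : ∀ z, ∀ f : C(X, ℝ), kernelOp μ (k z) f = f → f = 0) :
    ∃ w : C(Z, C(X, ℝ)), ∀ z, w z = φ z + kernelOp μ (k z) (w z) := by
  have hunit := fun z => isUnit_one_sub_kernelOp μ (k z) (hk z)
  have hinverse : Continuous fun z => Ring.inverse (1 - kernelOp μ (k z)) := by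
    refine continuous_iff_continuousAt.2 fun z => ?_
    obtain ⟨u, hu⟩ := hunit z
    have hz : ContinuousAt Ring.inverse (1 - kernelOp μ (k z)) := by
      rw [← hu]
      exact NormedRing.inverse_continuousAt (R := C(X, ℝ) →L[ℝ] C(X, ℝ)) u
    have hop : Continuous fun z => 1 - kernelOp μ (k z) := by fun_prop
    exact ContinuousAt.comp (f := fun z => 1 - kernelOp μ (k z)) hz hop.continuousAt
  refine ⟨⟨fun z => Ring.inverse (1 - kernelOp μ (k z)) (φ z),
    hinverse.clm_apply φ.continuous⟩, fun z => ?_⟩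
  have hsolves := congrArg (fun T : C(X, ℝ) →L[ℝ] C(X, ℝ) => T (φ z))
    (Ring.mul_inverse_cancel _ (hunit z))
  simp only [mul_apply_eq_comp, sub_apply, one_apply_eq_self] at hsolves
  exact eq_add_of_sub_eq hsolves

end KernelOperator

section IntegralEquation

variable {Z : Type*} [TopologicalSpace Z] {a b : ℝ} {k : Z → ℝ → ℝ → ℝ} {φ : Z → ℝ → ℝ}

theorem integral_Icc_subtype (hab : a ≤ b) (g : ℝ → ℝ) :
    ∫ t : Icc a b, g t ∂(volume.comap Subtype.val) = ∫ t in a..b, g t := by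
  rw [intervalIntegral.integral_of_le hab, ← integral_Icc_eq_integral_Ioc]
  exact integral_subtype_comap measurableSet_Icc g

theorem exists_solution_on_Icc (hab : a ≤ b)
    (hk : Continuous fun p : Z × ℝ × ℝ => k p.1 p.2.1 p.2.2)
    (hφ : Continuous fun p : Z × ℝ => φ p.1 p.2)
    (hinj : ∀ z, ∀ f : ℝ → ℝ, Continuous f →
      (∀ x ∈ Icc a b, f x = ∫ t in a..b, k z x t * f t) → ∀ x ∈ Icc a b, f x = 0) :
    ∃ w : C(Z, C(Icc a b, ℝ)), ∀ z, ∀ x : Icc a b,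
      w z x = φ z x + ∫ t in a..b, k z x t * IccExtend hab (w z) t := by
  let ν : Measure (Icc a b) := volume.comap Subtype.val
  have : IsFiniteMeasure ν := ⟨by
    rw [(MeasurableEmbedding.subtype_coe measurableSet_Icc).comap_apply, image_univ,
      Subtype.range_coe]
    exact measure_Icc_lt_top⟩
  let kIcc : C(Z, C(Icc a b × Icc a b, ℝ)) :=
    (ContinuousMap.mk (fun p : Z × (Icc a b × Icc a b) => k p.1 p.2.1 p.2.2) (by fun_prop)).curry
  let φIcc : C(Z, C(Icc a b, ℝ)) :=
    (ContinuousMap.mk (fun p : Z × Icc a b => φ p.1 p.2) (by fun_prop)).curry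
  have hop : ∀ z x, ∀ f : C(Icc a b, ℝ),
      kernelOp ν (kIcc z) f x = ∫ t in a..b, k z x t * IccExtend hab f t := by
    intro z x f
    rw [← integral_Icc_subtype hab, kernelOp_apply]
    simp [kIcc, ν]
  obtain ⟨w, hw⟩ := exists_continuousMap_solution ν kIcc φIcc (fun z f hf => by
    have hzero := hinj z (IccExtend hab f) f.continuous.Icc_extend' (fun x hx => by
      rw [← hop z ⟨x, hx⟩, hf, IccExtend_of_mem _ _ hx])
    ext x
    simpa using hzero x x.2)
  refine ⟨w, fun z x => ?_⟩
  rw [← hop]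
  exact DFunLike.congr_fun (hw z) x

theorem exists_solution (hab : a ≤ b) (hk : Continuous fun p : Z × ℝ × ℝ => k p.1 p.2.1 p.2.2)
    (hφ : Continuous fun p : Z × ℝ => φ p.1 p.2)
    (hinj : ∀ z, ∀ f : ℝ → ℝ, Continuous f →
      (∀ x ∈ Icc a b, f x = ∫ t in a..b, k z x t * f t) → ∀ x ∈ Icc a b, f x = 0) :
    ∃ w : Z → ℝ → ℝ, (Continuous fun p : Z × ℝ => w p.1 p.2) ∧
      ∀ z x, w z x = φ z x + ∫ t in a..b, k z x t * w z t := by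
  obtain ⟨w, hw⟩ := exists_solution_on_Icc hab hk hφ hinj
  have hw_cont : Continuous fun p : Z × ℝ => w p.1 (projIcc a b hab p.2) := by fun_prop
  have hintegrand : Continuous fun q : (Z × ℝ) × ℝ =>
      k q.1.1 q.1.2 q.2 * IccExtend hab (w q.1.1) q.2 :=
    (hk.comp (by fun_prop : Continuous fun q : (Z × ℝ) × ℝ => (q.1.1, q.1.2, q.2))).mul
      (hw_cont.comp (by fun_prop : Continuous fun q : (Z × ℝ) × ℝ => (q.1.1, q.2)))
  have hintegral := intervalIntegral.continuous_parametric_intervalIntegral_of_continuous'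
    (μ := volume) (f := fun (p : Z × ℝ) t => k p.1 p.2 t * IccExtend hab (w p.1) t) hintegrand a b
  refine ⟨fun z x => φ z x + ∫ t in a..b, k z x t * IccExtend hab (w z) t, hφ.add hintegral,
    fun z x => ?_⟩
  refine congrArg (φ z x + ·) (intervalIntegral.integral_congr fun t ht => ?_)
  rw [uIcc_of_le hab] at ht
  simp only [IccExtend_of_mem hab _ ht, hw z ⟨t, ht⟩]

end IntegralEquation

section Plancherel

open scoped FourierTransform

variable {V E : Type*} [NormedAddCommGroup V] [InnerProductSpace ℝ V] [FiniteDimensional ℝ V]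
  [MeasurableSpace V] [BorelSpace V] [NormedAddCommGroup E] [InnerProductSpace ℂ E] {f : V → E}

theorem continuous_fourier (hf : Integrable f) : Continuous (𝓕 f) :=
  VectorFourier.fourierIntegral_continuous Real.continuous_fourierChar
    (by exact continuous_inner) hf

theorem integral_norm_sq_eq_norm_sq {α : Type*} [MeasurableSpace α] {μ : Measure α}
    (F : Lp E 2 μ) : ∫ x, ‖F x‖ ^ 2 ∂μ = ‖F‖ ^ 2 := by
  have hinner : ∫ x, ((‖F x‖ : ℂ) ^ 2) ∂μ = (‖F‖ : ℂ) ^ 2 := by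
    simpa only [inner_self_eq_norm_sq_to_K] using! (L2.inner_def (𝕜 := ℂ) F F).symm
  simp only [← Complex.ofReal_pow, integral_complex_ofReal] at hinner
  exact Complex.ofReal_injective hinner

variable [CompleteSpace E]

theorem coeFn_fourier_toLp (hf : Integrable f) (hf2 : MemLp f 2) :
    (𝓕 (hf2.toLp f) : Lp E 2 (volume : Measure V)) =ᵐ[volume] 𝓕 f := by
  refine ae_eq_of_integral_contDiff_smul_eq ((Lp.memLp _).locallyIntegrable (by norm_num))
    (continuous_fourier hf).locallyIntegrable fun g hg hsupp => ?_
  let gS : SchwartzMap V ℂ := (hsupp.comp_left Complex.ofReal_zero).toSchwartzMap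
    (Complex.ofRealCLM.contDiff.comp hg)
  have hdistribution := DFunLike.congr_fun (Lp.fourier_toTemperedDistribution_eq (hf2.toLp f)) gS
  have hflip : ∫ v, 𝓕 gS v • f v = ∫ v, gS v • 𝓕 f v := by
    simpa using! VectorFourier.integral_fourierIntegral_smul_eq_flip (L := innerₗ V)
      Real.continuous_fourierChar continuous_inner gS.integrable hf
  have hae : ∫ v, 𝓕 gS v • hf2.toLp f v = ∫ v, 𝓕 gS v • f v :=
    integral_congr_ae (hf2.coeFn_toLp.mono fun v hv => by simp only [hv])
  simp only [TemperedDistribution.fourier_apply, Lp.toTemperedDistribution_apply] at hdistribution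
  rw [hae, hflip] at hdistribution
  exact hdistribution.symm

theorem memLp_fourier (hf : Integrable f) (hf2 : MemLp f 2) : MemLp (𝓕 f) 2 :=
  (memLp_congr_ae (coeFn_fourier_toLp hf hf2)).1 (Lp.memLp _)

theorem integral_norm_sq_fourier (hf : Integrable f) (hf2 : MemLp f 2) :
    ∫ v, ‖𝓕 f v‖ ^ 2 = ∫ v, ‖f v‖ ^ 2 := by
  calc ∫ v, ‖𝓕 f v‖ ^ 2
      = ∫ v, ‖(𝓕 (hf2.toLp f) : Lp E 2 (volume : Measure V)) v‖ ^ 2 :=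
        integral_congr_ae ((coeFn_fourier_toLp hf hf2).mono fun v hv => by simp only [hv])
    _ = ∫ v, ‖hf2.toLp f v‖ ^ 2 := by
        rw [integral_norm_sq_eq_norm_sq, integral_norm_sq_eq_norm_sq, Lp.norm_fourier_eq]
    _ = ∫ v, ‖f v‖ ^ 2 := integral_congr_ae (hf2.coeFn_toLp.mono fun v hv => by simp only [hv])

end Plancherel

theorem integral_integral_swap_of_continuousOn {E : Type*} [NormedAddCommGroup E]
    [NormedSpace ℝ E] {F : ℝ → ℝ → E} {a b c d : ℝ}
    (hF : ContinuousOn (Function.uncurry F) (uIcc a b ×ˢ uIcc c d)) :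
    ∫ x in a..b, ∫ y in c..d, F x y = ∫ y in c..d, ∫ x in a..b, F x y :=
  intervalIntegral_intervalIntegral_swap
    ((hF.integrableOn_compact (isCompact_uIcc.prod isCompact_uIcc)).mono_set
      (prod_mono uIoc_subset_uIcc uIoc_subset_uIcc))

section SineFun

theorem continuous_sineFun : Continuous fun p : ℝ × ℝ => sineFun p.1 p.2 := by
  unfold sineFun
  have := Real.continuous_sinc
  fun_prop

theorem sineFun_neg (ζ u : ℝ) : sineFun ζ (-u) = sineFun ζ u := by
  rw [sineFun, sineFun, mul_neg, Real.sinc_neg]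

theorem mul_sineFun_one (z u : ℝ) : z * sineFun 1 (z * u) = sineFun z u := by
  rw [sineFun, sineFun]
  ring_nf

theorem hasDerivAt_sineFun (ζ u : ℝ) :
    HasDerivAt (fun z => sineFun z u) (Real.cos (Real.pi * ζ * u)) ζ := by
  rcases eq_or_ne u 0 with rfl | hu
  · simpa [sineFun_zero] using hasDerivAt_id' ζ
  · simp_rw [sineFun_of_ne_zero _ hu]
    have hphase : HasDerivAt (fun z : ℝ => z * Real.pi * u) (Real.pi * u) ζ := by
      simpa using ((hasDerivAt_id' ζ).mul_const Real.pi).mul_const u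
    convert! hphase.sin.div_const (Real.pi * u) using 1
    rw [mul_div_assoc, div_self (mul_ne_zero Real.pi_ne_zero hu), mul_one, mul_comm ζ]

theorem integral_exp_eq_sineFun (ζ u : ℝ) :
    ∫ w in (-(ζ / 2))..(ζ / 2), Complex.exp (2 * Real.pi * Complex.I * u * w) = sineFun ζ u := by
  rcases eq_or_ne u 0 with rfl | hu
  · simp [sineFun_zero]
  · have hπu : (Real.pi * u : ℂ) ≠ 0 := by exact_mod_cast mul_ne_zero Real.pi_ne_zero hu
    have hc : (2 * Real.pi * Complex.I * u : ℂ) = 2 * Complex.I * (Real.pi * u) := by ring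
    have hphase : 2 * Complex.I * (Real.pi * u) * ((ζ / 2 : ℝ) : ℂ) =
        (ζ * Real.pi * u : ℂ) * Complex.I := by push_cast; ring
    rw [hc, integral_exp_mul_complex (by simpa using hπu), sineFun_of_ne_zero _ hu,
      Complex.ofReal_neg, mul_neg, hphase]
    push_cast
    rw [Complex.sin]
    field_simp
    linear_combination (Complex.exp (ζ * Real.pi * u * Complex.I) -
      Complex.exp (-(ζ * Real.pi * u * Complex.I))) / u * Complex.I_sq

end SineFun

section TimeLimited

open scoped FourierTransform

/-- The two-sided Laplace transform of the restriction of `f` to `[a, b]`; it is the entire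
extension of the Fourier transform of that restriction. -/
def laplaceOn (a b : ℝ) (f : ℝ → ℂ) (z : ℂ) : ℂ := ∫ t in a..b, Complex.exp (z * t) * f t

variable {a b : ℝ} {f : ℝ → ℂ}

theorem differentiable_laplaceOn (hf : IntervalIntegrable f volume a b) :
    Differentiable ℂ (laplaceOn a b f) := by
  intro z₀
  have hcont : Continuous fun p : ℂ × ℝ => (p.2 : ℂ) * Complex.exp (p.1 * p.2) := by fun_prop
  obtain ⟨C, hC⟩ := ((isCompact_closedBall z₀ 1).prod isCompact_uIcc).exists_bound_of_continuousOn
    (hcont.continuousOn (s := Metric.closedBall z₀ 1 ×ˢ uIcc a b))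
  have hmeas : ∀ g : ℝ → ℂ, Continuous g →
      AEStronglyMeasurable (fun t => g t * f t) (volume.restrict (uIoc a b)) :=
    fun g hg => hg.aestronglyMeasurable.mul hf.aestronglyMeasurable_restrict_uIoc
  refine (intervalIntegral.hasDerivAt_integral_of_dominated_loc_of_deriv_le
    (F' := fun z t => t * Complex.exp (z * t) * f t) (bound := fun t => C * ‖f t‖)
    (Metric.closedBall_mem_nhds z₀ one_pos)
    (Filter.Eventually.of_forall fun z => hmeas _ (by fun_prop))
    (hf.continuousOn_mul (by fun_prop)) (hmeas _ (by fun_prop)) ?_ (hf.norm.const_mul C)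
    ?_).2.differentiableAt
  · refine Filter.Eventually.of_forall fun t ht z hz => ?_
    rw [norm_mul]
    exact mul_le_mul_of_nonneg_right (hC (z, t) ⟨hz, uIoc_subset_uIcc ht⟩) (norm_nonneg _)
  · refine Filter.Eventually.of_forall fun t _ z _ => ?_
    simpa [mul_comm] using (((hasDerivAt_id' z).mul_const (t : ℂ)).cexp).mul_const (f t)

theorem fourier_indicator_Ioc (hab : a ≤ b) (w : ℝ) :
    𝓕 ((Ioc a b).indicator f) w = laplaceOn a b f (-(2 * Real.pi * Complex.I * w)) := by
  rw [Real.fourier_real_eq_integral_exp_smul, laplaceOn, intervalIntegral.integral_of_le hab,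
    ← integral_indicator measurableSet_Ioc]
  refine integral_congr_ae (Filter.Eventually.of_forall fun t => ?_)
  by_cases ht : t ∈ Ioc a b
  · simp only [indicator_of_mem ht, smul_eq_mul]
    push_cast
    ring_nf
  · simp [indicator_of_notMem ht]


theorem laplaceOn_eq_zero_of_fourier_eq_zero (hf : IntervalIntegrable f volume a b) {c : ℝ}
    (hzero : ∀ w : ℝ, c < w → laplaceOn a b f (-(2 * Real.pi * Complex.I * w)) = 0) :
    laplaceOn a b f = 0 := by
  let g : ℂ → ℂ := fun z => laplaceOn a b f (-(2 * Real.pi * Complex.I * z))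
  have hg : Differentiable ℂ g := (differentiable_laplaceOn hf).comp (by fun_prop)
  have htendsto : Filter.Tendsto (fun w : ℝ => (w : ℂ)) (nhdsWithin c (Ioi c))
      (nhdsWithin (c : ℂ) {(c : ℂ)}ᶜ) :=
    tendsto_nhdsWithin_of_tendsto_nhds_of_eventually_within _
      (Complex.continuous_ofReal.continuousAt.tendsto.mono_left nhdsWithin_le_nhds)
      (eventually_mem_nhdsWithin.mono fun w hw h => hw.ne' (Complex.ofReal_injective h))
  have hg_zero : g = 0 := AnalyticOnNhd.eq_of_frequently_eq (z₀ := (c : ℂ))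
    (fun z _ => hg.analyticAt z) (fun z _ => analyticAt_const)
    (htendsto.frequently
      ((eventually_mem_nhdsWithin (s := Ioi c)).mono fun w hw => hzero w hw).frequently)
  funext z
  have hz : -(2 * Real.pi * Complex.I * (z * Complex.I / (2 * Real.pi))) = z := by
    have : (Real.pi : ℂ) ≠ 0 := Complex.ofReal_ne_zero.2 Real.pi_ne_zero
    field_simp
    linear_combination -z * Complex.I_sq
  simpa only [g, hz, Pi.zero_apply] using congrFun hg_zero (z * Complex.I / (2 * Real.pi))

theorem integral_mul_laplaceOn (hf : ContinuousOn f (Icc a b)) (hab : a ≤ b) {g : ℝ → ℂ}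
    (hg : Continuous g) (c d : ℝ) :
    ∫ w in c..d, g w * laplaceOn a b f (-(2 * Real.pi * Complex.I * w)) =
      ∫ t in a..b, (∫ w in c..d, g w * Complex.exp (-(2 * Real.pi * Complex.I * w) * t)) * f t := by
  simp only [laplaceOn, ← intervalIntegral.integral_const_mul,
    ← intervalIntegral.integral_mul_const, ← mul_assoc]
  refine integral_integral_swap_of_continuousOn
    (F := fun w t => g w * Complex.exp (-(2 * Real.pi * Complex.I * w) * t) * f t) ?_
  rw [uIcc_of_le hab]
  exact (by fun_prop : Continuous _).continuousOn.mul
    (hf.comp continuousOn_snd fun p hp => hp.2)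

theorem integral_exp_mul_laplaceOn (hf : ContinuousOn f (Icc a b)) (hab : a ≤ b) (ζ x : ℝ) :
    ∫ w in (-(ζ / 2))..(ζ / 2), Complex.exp (2 * Real.pi * Complex.I * x * w) *
        laplaceOn a b f (-(2 * Real.pi * Complex.I * w)) =
      ∫ t in a..b, sineFun ζ (x - t) * f t := by
  rw [integral_mul_laplaceOn hf hab (by fun_prop)]
  simp only [← Complex.exp_add, ← integral_exp_eq_sineFun]
  congr! 6
  push_cast
  ring

theorem integral_norm_sq_laplaceOn (hf : ContinuousOn f (Icc a b)) (hab : a ≤ b) {ζ : ℝ}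
    (h : ∀ x ∈ Icc a b, f x = ∫ t in a..b, sineFun ζ (x - t) * f t) :
    ∫ w in (-(ζ / 2))..(ζ / 2), ‖laplaceOn a b f (-(2 * Real.pi * Complex.I * w))‖ ^ 2 =
      ∫ t in a..b, ‖f t‖ ^ 2 := by
  have hint : IntervalIntegrable f volume a b := hf.intervalIntegrable_of_Icc hab
  let E : ℝ → ℂ := fun w => laplaceOn a b f (-(2 * Real.pi * Complex.I * w))
  have hE : Continuous E := (differentiable_laplaceOn hint).continuous.comp (by fun_prop)
  have hinverse : ∀ t ∈ Icc a b, ∫ w in (-(ζ / 2))..(ζ / 2),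
      (starRingEnd ℂ) (E w) * Complex.exp (-(2 * Real.pi * Complex.I * w) * t) =
        (starRingEnd ℂ) (f t) := by
    intro t ht
    rw [h t ht, ← integral_exp_mul_laplaceOn hf hab, ← intervalIntegral.intervalIntegral_conj]
    refine intervalIntegral.integral_congr fun w _ => ?_
    simp only [map_mul, ← Complex.exp_conj, Complex.conj_ofReal, Complex.conj_I, map_ofNat, E]
    ring_nf
  have hcomplex : ∫ w in (-(ζ / 2))..(ζ / 2), (starRingEnd ℂ) (E w) * E w =
      ∫ t in a..b, (starRingEnd ℂ) (f t) * f t := by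
    rw [integral_mul_laplaceOn hf hab (by fun_prop)]
    refine intervalIntegral.integral_congr fun t ht => ?_
    simp only [hinverse t (by rwa [uIcc_of_le hab] at ht)]
  simp only [Complex.conj_mul', ← Complex.ofReal_pow, intervalIntegral.integral_ofReal] at hcomplex
  exact Complex.ofReal_injective hcomplex

theorem eq_zero_of_integral_Ioi_le_zero {g : ℝ → ℝ} (hg : Continuous g) (hg0 : 0 ≤ g) {c : ℝ}
    (hint : IntegrableOn g (Ioi c)) (h : ∫ w in Ioi c, g w ≤ 0) : ∀ w, c < w → g w = 0 := by
  have hae : g =ᵐ[volume.restrict (Ioi c)] 0 :=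
    (setIntegral_eq_zero_iff_of_nonneg_ae (Filter.Eventually.of_forall hg0) hint).1
      (h.antisymm (integral_nonneg hg0))
  exact fun w hw => Measure.eqOn_open_of_ae_eq hae isOpen_Ioi hg.continuousOn continuousOn_const hw

theorem memLp_indicator_Ioc (hf : ContinuousOn f (Icc a b)) (p : ENNReal) :
    MemLp ((Ioc a b).indicator f) p := by
  obtain ⟨C, hC⟩ := isCompact_Icc.exists_bound_of_continuousOn hf
  have : IsFiniteMeasure (volume.restrict (Ioc a b)) := ⟨by simp⟩
  exact (memLp_indicator_iff_restrict measurableSet_Ioc).2 (MemLp.of_bound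
    ((hf.mono Ioc_subset_Icc_self).aestronglyMeasurable measurableSet_Ioc) C
    (ae_restrict_of_forall_mem measurableSet_Ioc fun t ht => hC t (Ioc_subset_Icc_self ht)))

theorem integral_norm_sq_fourier_indicator (hf : ContinuousOn f (Icc a b)) (hab : a ≤ b) :
    ∫ w, ‖𝓕 ((Ioc a b).indicator f) w‖ ^ 2 = ∫ t in a..b, ‖f t‖ ^ 2 := by
  have hsq : (fun t => ‖(Ioc a b).indicator f t‖ ^ 2) =
      (Ioc a b).indicator fun t => ‖f t‖ ^ 2 := by
    ext t
    by_cases ht : t ∈ Ioc a b <;> simp [ht]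
  rw [integral_norm_sq_fourier (memLp_one_iff_integrable.1 (memLp_indicator_Ioc hf 1))
    (memLp_indicator_Ioc hf 2), hsq, integral_indicator measurableSet_Ioc,
    intervalIntegral.integral_of_le hab]

theorem eqOn_zero_of_integral_norm_sq_eq_zero (hf : ContinuousOn f (Icc a b)) (hab : a < b)
    (h : ∫ t in a..b, ‖f t‖ ^ 2 = 0) : EqOn f 0 (Icc a b) := by
  have hsq : ContinuousOn (fun t => ‖f t‖ ^ 2) (Icc a b) := by fun_prop
  intro x hx
  by_contra hfx
  have hpos : 0 < ‖f x‖ ^ 2 := pow_pos (norm_pos_iff.2 hfx) 2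
  exact (intervalIntegral.integral_pos hab hsq (fun t _ => by positivity) ⟨x, hx, hpos⟩).ne' h

theorem eqOn_zero_of_eq_integral_sineFun (hf : ContinuousOn f (Icc a b)) (hab : a < b) {ζ : ℝ}
    (h : ∀ x ∈ Icc a b, f x = ∫ t in a..b, sineFun ζ (x - t) * f t) : EqOn f 0 (Icc a b) := by
  have hint : IntervalIntegrable f volume a b := hf.intervalIntegrable_of_Icc hab.le
  have hF : Integrable ((Ioc a b).indicator f) :=
    memLp_one_iff_integrable.1 (memLp_indicator_Ioc hf 1)
  let G : ℝ → ℝ := fun w => ‖𝓕 ((Ioc a b).indicator f) w‖ ^ 2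
  have hG : Continuous G := by
    have := continuous_fourier hF
    fun_prop
  have hG_int : Integrable G :=
    (memLp_fourier hF (memLp_indicator_Ioc hf 2)).integrable_norm_pow two_ne_zero
  have hG_band : ∫ w in (-(ζ / 2))..(ζ / 2), G w = ∫ w, G w := by
    rw [integral_norm_sq_fourier_indicator hf hab.le, ← integral_norm_sq_laplaceOn hf hab.le h]
    simp only [G, fourier_indicator_Ioc hab.le]
  have hG_tail : ∫ w in Ioi (ζ / 2), G w ≤ 0 := by
    have htotal := intervalIntegral.integral_Iic_add_Ioi (b := ζ / 2) hG_int.integrableOn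
      hG_int.integrableOn
    have hband := intervalIntegral.integral_Iic_sub_Iic (a := -(ζ / 2)) (b := ζ / 2)
      hG_int.integrableOn hG_int.integrableOn
    have hleft : 0 ≤ ∫ w in Iic (-(ζ / 2)), G w := integral_nonneg fun w => by positivity
    linarith
  have hlaplace : laplaceOn a b f = 0 :=
    laplaceOn_eq_zero_of_fourier_eq_zero hint fun w hw => by
      simpa [G, fourier_indicator_Ioc hab.le] using eq_zero_of_integral_Ioi_le_zero hG
        (fun w => by positivity) hG_int.integrableOn hG_tail w hw
  exact eqOn_zero_of_integral_norm_sq_eq_zero hf hab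
    (by simp [← integral_norm_sq_laplaceOn hf hab.le h, hlaplace])

theorem eqOn_zero_of_eq_integral_sineFun_real {f : ℝ → ℝ} (hf : ContinuousOn f (Icc a b))
    (hab : a < b) {ζ : ℝ} (h : ∀ x ∈ Icc a b, f x = ∫ t in a..b, sineFun ζ (x - t) * f t) :
    EqOn f 0 (Icc a b) := by
  have hcomplex := eqOn_zero_of_eq_integral_sineFun (f := fun t => (f t : ℂ)) (by fun_prop) hab
    (fun x hx => by
      rw [h x hx, ← intervalIntegral.integral_ofReal]
      push_cast
      rfl)
  exact fun x hx => by simpa using hcomplex hx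

end TimeLimited

section EvenOdd

theorem abs_sineFun_le (ζ u : ℝ) : |sineFun ζ u| ≤ |ζ| := by
  rw [sineFun, abs_mul]
  exact mul_le_of_le_one_right (abs_nonneg ζ) (Real.abs_sinc_le_one _)

theorem continuous_kPM (ε : ℝ) : Continuous fun p : ℝ × ℝ × ℝ => kPM ε p.1 p.2.1 p.2.2 := by
  have hsub : Continuous fun p : ℝ × ℝ × ℝ => sineFun p.1 (p.2.1 - p.2.2) :=
    continuous_sineFun.comp (by fun_prop : Continuous fun p : ℝ × ℝ × ℝ => (p.1, p.2.1 - p.2.2))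
  have hadd : Continuous fun p : ℝ × ℝ × ℝ => sineFun p.1 (p.2.1 + p.2.2) :=
    continuous_sineFun.comp (by fun_prop : Continuous fun p : ℝ × ℝ × ℝ => (p.1, p.2.1 + p.2.2))
  unfold kPM
  fun_prop

theorem kPM_symm (ε z x t : ℝ) : kPM ε z x t = kPM ε z t x := by
  rw [kPM, kPM, ← sineFun_neg z (x - t), neg_sub, add_comm x t]

theorem mul_kPM_one (ε z x t : ℝ) : z * kPM ε 1 (z * x) (z * t) = kPM ε z x t := by
  rw [kPM, kPM, ← mul_sineFun_one z (x - t), ← mul_sineFun_one z (x + t)]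
  ring_nf

variable {ε : ℝ} (hε : ε = 1 ∨ ε = -1)
include hε

theorem kPM_neg_left (z x t : ℝ) : kPM ε z (-x) t = ε * kPM ε z x t := by
  rw [kPM, kPM, ← sineFun_neg z (-x - t), ← sineFun_neg z (-x + t)]
  rcases hε with rfl | rfl <;> ring_nf

theorem abs_kPM_le (z x t : ℝ) : |kPM ε z x t| ≤ |z| := by
  have hsub := abs_le.1 (abs_sineFun_le z (x - t))
  have hadd := abs_le.1 (abs_sineFun_le z (x + t))
  rw [kPM, abs_le]
  rcases hε with rfl | rfl <;> constructor <;> linarith [hsub.1, hsub.2, hadd.1, hadd.2]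

theorem integral_kPM_mul {z L x : ℝ} (hL : 0 ≤ L) {f : ℝ → ℝ}
    (hf : ContinuousOn f (Icc (-L) L)) (hparity : ∀ t ∈ Icc (-L) L, f (-t) = ε * f t) :
    ∫ t in (-L)..L, kPM ε z x t * f t = ∫ t in (-L)..L, sineFun z (x - t) * f t := by
  have hLL : -L ≤ L := by linarith
  have hint : ∀ g : ℝ → ℝ, Continuous g →
      IntervalIntegrable (fun t => sineFun z (g t) * f t) volume (-L) L := fun g hg =>
    (((continuous_sineFun.comp (continuous_const.prodMk hg)).continuousOn.mul
      hf).intervalIntegrable_of_Icc hLL)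
  have hreflect : ∫ t in (-L)..L, sineFun z (x + t) * f t =
      ε * ∫ t in (-L)..L, sineFun z (x - t) * f t := by
    have hneg := intervalIntegral.integral_comp_neg (a := -L) (b := L)
      (fun t => sineFun z (x + t) * f t)
    rw [neg_neg] at hneg
    rw [← hneg, ← intervalIntegral.integral_const_mul]
    refine intervalIntegral.integral_congr fun t ht => ?_
    rw [uIcc_of_le hLL] at ht
    simp only [hparity t ht, ← sub_eq_add_neg]
    ring
  calc ∫ t in (-L)..L, kPM ε z x t * f t
      = ∫ t in (-L)..L, (sineFun z (x - t) * f t + ε * (sineFun z (x + t) * f t)) / 2 :=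
        intervalIntegral.integral_congr fun t _ => by
          simp only [kPM]
          ring
    _ = ((∫ t in (-L)..L, sineFun z (x - t) * f t) +
          ε * ∫ t in (-L)..L, sineFun z (x + t) * f t) / 2 := by
        rw [intervalIntegral.integral_div, intervalIntegral.integral_add (hint _ (by fun_prop))
          ((hint _ (by fun_prop)).const_mul ε), intervalIntegral.integral_const_mul]
    _ = ∫ t in (-L)..L, sineFun z (x - t) * f t := by
        rw [hreflect]
        rcases hε with rfl | rfl <;> ring

theorem eqOn_zero_of_eq_integral_kPM {z : ℝ} {f : ℝ → ℝ} (hf : ContinuousOn f (Icc (-1) 1))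
    (h : ∀ x ∈ Icc (-1 : ℝ) 1, f x = ∫ t in (-1 : ℝ)..1, kPM ε z x t * f t) :
    EqOn f 0 (Icc (-1) 1) := by
  have hparity : ∀ t ∈ Icc (-1 : ℝ) 1, f (-t) = ε * f t := fun t ht => by
    rw [h t ht, h (-t) (neg_mem_Icc_iff.2 (by simpa using ht)),
      ← intervalIntegral.integral_const_mul]
    simp only [kPM_neg_left hε, mul_assoc]
  refine eqOn_zero_of_eq_integral_sineFun_real hf (by norm_num) (ζ := z) fun x hx => ?_
  rw [h x hx, integral_kPM_mul hε zero_le_one hf hparity]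

end EvenOdd

section TrigPM

/-- The function `cos (π x)` for `ε = 1`, and `sin (π x)` for `ε = -1`. -/
def trigPM (ε x : ℝ) : ℝ :=
  (1 + ε) / 2 * Real.cos (Real.pi * x) + (1 - ε) / 2 * Real.sin (Real.pi * x)

theorem continuous_trigPM (ε : ℝ) : Continuous (trigPM ε) := by
  unfold trigPM
  fun_prop

theorem trigPM_one (x : ℝ) : trigPM 1 x = Real.cos (Real.pi * x) := by
  rw [trigPM]
  norm_num

theorem trigPM_neg_one (x : ℝ) : trigPM (-1) x = Real.sin (Real.pi * x) := by
  rw [trigPM]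
  norm_num

variable {ε : ℝ} (hε : ε = 1 ∨ ε = -1)
include hε

theorem trigPM_neg (x : ℝ) : trigPM ε (-x) = ε * trigPM ε x := by
  rcases hε with rfl | rfl <;> simp [trigPM_one, trigPM_neg_one]

theorem abs_trigPM_le (x : ℝ) : |trigPM ε x| ≤ 1 := by
  rcases hε with rfl | rfl
  · rw [trigPM_one]
    exact Real.abs_cos_le_one _
  · rw [trigPM_neg_one]
    exact Real.abs_sin_le_one _

theorem hasDerivAt_kPM (z x t : ℝ) :
    HasDerivAt (fun z => kPM ε z x t) (trigPM ε (z * x) * trigPM ε (z * t)) z := by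
  convert! ((hasDerivAt_sineFun z (x - t)).add
    ((hasDerivAt_sineFun z (x + t)).const_mul ε)).div_const 2 using 1
  rw [mul_sub, mul_add, Real.cos_sub, Real.cos_add]
  rcases hε with rfl | rfl
  · rw [trigPM_one, trigPM_one]
    ring_nf
  · rw [trigPM_neg_one, trigPM_neg_one]
    ring_nf

end TrigPM

section Determinants

theorem abs_det_le_of_abs_le {n : ℕ} (A : Matrix (Fin n) (Fin n) ℝ) {M : ℝ}
    (hA : ∀ i j, |A i j| ≤ M) : |A.det| ≤ (√n * M) ^ n := by
  let b := EuclideanSpace.basisFun (Fin n) ℝ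
  let rows : Fin n → EuclideanSpace ℝ (Fin n) := fun i => WithLp.toLp 2 (A i)
  have : Fact (Module.finrank ℝ (EuclideanSpace ℝ (Fin n)) = n) := ⟨by simp⟩
  have hdet : A.det = b.toBasis.det rows := by
    rw [Module.Basis.det_apply, ← Matrix.det_transpose]
    congr 1
  have hvolume := b.toBasis.orientation.abs_volumeForm_apply_le rows
  rw [Orientation.volumeForm_robust' _ b, ← hdet] at hvolume
  have hrow : ∀ i, ‖rows i‖ ≤ √n * M := by
    intro i
    have hM : 0 ≤ M := (abs_nonneg _).trans (hA i i)
    rw [EuclideanSpace.norm_eq, ← Real.sqrt_sq hM, ← Real.sqrt_mul (by positivity)]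
    refine Real.sqrt_le_sqrt ?_
    calc ∑ j, ‖rows i j‖ ^ 2 ≤ ∑ _j : Fin n, M ^ 2 :=
          Finset.sum_le_sum fun j _ => pow_le_pow_left₀ (norm_nonneg _) (hA i j) 2
      _ = n * M ^ 2 := by simp
  calc |A.det| ≤ ∏ i, ‖rows i‖ := hvolume
    _ ≤ ∏ _i : Fin n, (√n * M) :=
        Finset.prod_le_prod (fun _ _ => norm_nonneg _) fun i _ => hrow i
    _ = (√n * M) ^ n := by simp

theorem measurable_det {R ι β : Type*} [CommRing R] [MeasurableSpace R] [MeasurableAdd₂ R]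
    [MeasurableMul₂ R] [Fintype ι] [DecidableEq ι] [MeasurableSpace β] {A : β → Matrix ι ι R}
    (hA : ∀ i j, Measurable fun b => A b i j) : Measurable fun b => (A b).det := by
  simp only [Matrix.det_apply']
  exact Finset.measurable_fun_sum _ fun σ _ =>
    (Finset.measurable_fun_prod _ fun i _ => hA _ _).const_mul _

theorem hasDerivAt_det {ι 𝕜 : Type*} [Fintype ι] [DecidableEq ι] [NontriviallyNormedField 𝕜]
    {A : 𝕜 → Matrix ι ι 𝕜} {A' : Matrix ι ι 𝕜} {z : 𝕜}
    (hA : ∀ i j, HasDerivAt (fun z => A z i j) (A' i j) z) :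
    HasDerivAt (fun z => (A z).det) (∑ i, ((A z).updateRow i (A' i)).det) z := by
  let det : ContinuousMultilinearMap 𝕜 (fun _ : ι => ι → 𝕜) 𝕜 :=
    ⟨(Matrix.detRowAlternating (n := ι) (R := 𝕜)).toMultilinearMap,
      Continuous.matrix_det continuous_id⟩
  have hrows : HasDerivAt (fun z => (fun i j => A z i j : ι → ι → 𝕜)) (fun i j => A' i j) z :=
    hasDerivAt_pi.2 fun i => hasDerivAt_pi.2 fun j => hA i j
  have hcomp := (det.hasFDerivAt (fun i j => A z i j)).comp_hasDerivAt z hrows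
  rw [ContinuousMultilinearMap.linearDeriv_apply] at hcomp
  exact hcomp

theorem sq_sqrt_mul_pow_div_factorial_le (C : ℝ) (n : ℕ) :
    ((√n * C) ^ n / n.factorial) ^ 2 ≤ (Real.exp 1 * C ^ 2) ^ n / n.factorial := by
  have hfactorial : (0 : ℝ) < n.factorial := by positivity
  have hpow : (n : ℝ) ^ n ≤ Real.exp 1 ^ n * n.factorial := by
    have := Real.pow_div_factorial_le_exp n (by positivity) n
    rwa [div_le_iff₀ hfactorial, ← mul_one (n : ℝ), Real.exp_nat_mul, mul_one] at this
  calc ((√n * C) ^ n / n.factorial) ^ 2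
      = (n : ℝ) ^ n * (C ^ 2) ^ n / n.factorial ^ 2 := by
        rw [div_pow, ← pow_mul, mul_comm n 2, pow_mul, mul_pow, Real.sq_sqrt (by positivity),
          mul_pow]
    _ ≤ Real.exp 1 ^ n * n.factorial * (C ^ 2) ^ n / n.factorial ^ 2 := by gcongr
    _ = (Real.exp 1 * C ^ 2) ^ n / n.factorial := by
        rw [mul_pow]
        field_simp

theorem summable_sqrt_mul_pow_div_factorial (C : ℝ) :
    Summable fun n : ℕ => (√n * C) ^ n / n.factorial := by
  have hmajorant : Summable fun n : ℕ =>
      ((Real.exp 1 * (2 * C) ^ 2) ^ n / n.factorial + (1 / 4 : ℝ) ^ n) / 2 :=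
    ((Real.summable_pow_div_factorial _).add
      (summable_geometric_of_lt_one (by norm_num) (by norm_num))).div_const 2
  refine Summable.of_norm_bounded hmajorant fun n => ?_
  set x := (Real.exp 1 * (2 * C) ^ 2) ^ n / n.factorial with hx
  have hsq : ((√n * C) ^ n / n.factorial) ^ 2 ≤ x * (1 / 4) ^ n := by
    refine (sq_sqrt_mul_pow_div_factorial_le C n).trans_eq ?_
    rw [hx, div_mul_eq_mul_div, ← mul_pow]
    ring_nf
  have : 0 ≤ x := by positivity
  refine abs_le_of_sq_le_sq ?_ (by positivity)
  -- the geometric mean of `x` and `4⁻ⁿ` is at most their arithmetic mean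
  nlinarith [sq_nonneg (x - (1 / 4 : ℝ) ^ n)]

end Determinants

section KernelMatrix

variable {α : Type*}

/-- The matrix of the values of the kernel `k` at the points `y`, whose determinant is integrated
in the Fredholm series. -/
def kernelMatrix (k : α → α → ℝ) {n : ℕ} (y : Fin n → α) : Matrix (Fin n) (Fin n) ℝ :=
  Matrix.of fun i j => k (y i) (y j)

/-- The matrix of the kernel `k` at the points `x, y₁, …, yₙ` with the row of the point `x` replaced
by the values of `ψ`. Its determinant is the numerator in Fredholm's formula for the resolvent. -/
def borderedMatrix (k : α → α → ℝ) (ψ : α → ℝ) {n : ℕ} (x : α) (y : Fin n → α) :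
    Matrix (Fin (n + 1)) (Fin (n + 1)) ℝ :=
  (kernelMatrix k (Matrix.vecCons x y)).updateRow 0 (ψ ∘ Matrix.vecCons x y)

variable {k : α → α → ℝ} {ψ : α → ℝ} {n : ℕ}

theorem borderedMatrix_zero (x : α) (y : Fin n → α) (j : Fin (n + 1)) :
    borderedMatrix k ψ x y 0 j = ψ (Matrix.vecCons x y j) := by
  rw [borderedMatrix, Matrix.updateRow_self, Function.comp_apply]

theorem borderedMatrix_succ (x : α) (y : Fin n → α) (i : Fin n) (j : Fin (n + 1)) :
    borderedMatrix k ψ x y i.succ j = k (y i) (Matrix.vecCons x y j) := by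
  rw [borderedMatrix, Matrix.updateRow_ne (Fin.succ_ne_zero i), kernelMatrix, Matrix.of_apply,
    Matrix.cons_val_succ]

theorem vecCons_removeNth (y : Fin (n + 1) → α) (i : Fin (n + 1)) :
    Matrix.vecCons (y i) (i.removeNth y) = y ∘ i.cycleRange.symm :=
  Fin.cons_removeNth_eq_comp_cycleRange_symm y i

theorem det_updateRow_kernelMatrix (y : Fin (n + 1) → α) (i : Fin (n + 1)) :
    ((kernelMatrix k y).updateRow i (ψ ∘ y)).det =
      (borderedMatrix k ψ (y i) (i.removeNth y)).det := by
  have hrow : i.cycleRange.symm.symm i = 0 := by simp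
  rw [borderedMatrix, vecCons_removeNth, ← Matrix.det_submatrix_equiv_self i.cycleRange.symm,
    Matrix.submatrix_updateRow_equiv, hrow]
  rfl

theorem borderedMatrix_eq_submatrix (x : α) (y : Fin (n + 1) → α) (i : Fin (n + 1)) :
    borderedMatrix k ψ (y i) (i.removeNth y) =
      ((borderedMatrix k ψ x y).submatrix i.succ.succAbove Fin.succ).submatrix id
        i.cycleRange.symm := by
  ext a b
  have hy := congrFun (vecCons_removeNth y i) b
  cases a using Fin.cases with
  | zero => simp [borderedMatrix_zero, hy]
  | succ a => simp [borderedMatrix_succ, hy, Fin.removeNth_apply]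

theorem det_borderedMatrix_succ (x : α) (y : Fin (n + 1) → α) :
    (borderedMatrix k ψ x y).det = ψ x * (kernelMatrix k y).det -
      ∑ i, k (y i) x * (borderedMatrix k ψ (y i) (i.removeNth y)).det := by
  rw [Matrix.det_succ_column_zero, Fin.sum_univ_succ, sub_eq_add_neg, ← Finset.sum_neg_distrib]
  congr 1
  · have hminor : (borderedMatrix k ψ x y).submatrix (Fin.succAbove 0) Fin.succ =
        kernelMatrix k y := by
      ext i j
      simp [borderedMatrix_succ, kernelMatrix]
    rw [hminor, borderedMatrix_zero, Matrix.cons_val_zero, Fin.val_zero, pow_zero, one_mul]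
  · refine Finset.sum_congr rfl fun i _ => ?_
    rw [borderedMatrix_eq_submatrix x, Matrix.det_permute', Equiv.Perm.sign_symm,
      Fin.sign_cycleRange, borderedMatrix_succ, Matrix.cons_val_zero, Fin.val_succ]
    push_cast
    ring

theorem measurable_det_kernelMatrix [MeasurableSpace α] (hk : Measurable (Function.uncurry k)) :
    Measurable fun y : Fin n → α => (kernelMatrix k y).det :=
  measurable_det fun i j => hk.comp
    (by fun_prop : Measurable fun y : Fin n → α => (y i, y j))

theorem measurable_det_borderedMatrix [MeasurableSpace α] (hk : Measurable (Function.uncurry k))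
    (hψ : Measurable ψ) :
    Measurable fun p : α × (Fin n → α) => (borderedMatrix k ψ p.1 p.2).det := by
  have hcons : ∀ j, Measurable fun p : α × (Fin n → α) => Matrix.vecCons p.1 p.2 j := by
    intro j
    cases j using Fin.cases with
    | zero => exact measurable_fst
    | succ j => exact (measurable_pi_apply j).comp measurable_snd
  refine measurable_det fun i j => ?_
  cases i using Fin.cases with
  | zero =>
    simp only [borderedMatrix_zero]
    exact hψ.comp (hcons j)
  | succ i =>
    simp only [borderedMatrix_succ]
    exact hk.comp (((measurable_pi_apply i).comp measurable_snd).prodMk (hcons j))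

theorem abs_det_kernelMatrix_le {M : ℝ} (hkM : ∀ x t, |k x t| ≤ M) (y : Fin n → α) :
    |(kernelMatrix k y).det| ≤ (√n * M) ^ n :=
  abs_det_le_of_abs_le _ fun _ _ => hkM _ _

theorem abs_det_borderedMatrix_le {M : ℝ} (hkM : ∀ x t, |k x t| ≤ M) (hψM : ∀ x, |ψ x| ≤ M)
    (x : α) (y : Fin n → α) :
    |(borderedMatrix k ψ x y).det| ≤ (√(n + 1 : ℕ) * M) ^ (n + 1) := by
  refine abs_det_le_of_abs_le _ fun i j => ?_
  cases i using Fin.cases with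
  | zero => simpa only [borderedMatrix_zero] using hψM _
  | succ i => simpa only [borderedMatrix_succ] using hkM _ _

end KernelMatrix

section FredholmSeries

variable {α : Type*} [MeasurableSpace α] (μ : Measure α)

theorem integral_sum_removeNth [SigmaFinite μ] {n : ℕ} {G : α × (Fin n → α) → ℝ}
    (hG : Integrable G (μ.prod (Measure.pi fun _ : Fin n => μ))) :
    ∫ y, ∑ i, G (y i, i.removeNth y) ∂(Measure.pi fun _ : Fin (n + 1) => μ) =
      (n + 1) * ∫ x, ∫ y, G (x, y) ∂(Measure.pi fun _ : Fin n => μ) ∂μ := by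
  have hsplit := fun i => measurePreserving_piFinSuccAbove (fun _ : Fin (n + 1) => μ) i
  have hint : ∀ i : Fin (n + 1),
      Integrable (fun y => G (y i, i.removeNth y)) (Measure.pi fun _ : Fin (n + 1) => μ) :=
    fun i => (hsplit i).integrable_comp_of_integrable hG
  have hterm : ∀ i : Fin (n + 1),
      ∫ y, G (y i, i.removeNth y) ∂(Measure.pi fun _ : Fin (n + 1) => μ) =
        ∫ x, ∫ y, G (x, y) ∂(Measure.pi fun _ : Fin n => μ) ∂μ := fun i =>
    ((hsplit i).integral_comp' G).trans (integral_prod G hG)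
  rw [integral_finsetSum _ fun i _ => hint i]
  simp [hterm]

/-- The integral `∫ det (k (yᵢ, yⱼ)) dy` over `n` variables in the Fredholm series. -/
def fredholmCoeff (k : α → α → ℝ) (n : ℕ) : ℝ :=
  ∫ y, (kernelMatrix k y).det ∂(Measure.pi fun _ : Fin n => μ)

/-- The integral of the bordered determinant over the last `n` of its points; these are the
coefficients of the Fredholm minor of `k` applied to `ψ`. -/
def borderedCoeff (k : α → α → ℝ) (ψ : α → ℝ) (n : ℕ) (x : α) : ℝ :=
  ∫ y, (borderedMatrix k ψ x y).det ∂(Measure.pi fun _ : Fin n => μ)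

/-- The factor `(-1)ⁿ / n!` in the Fredholm series. -/
def fredholmWeight (n : ℕ) : ℝ := (-1) ^ n / n.factorial

/-- The Fredholm determinant `det (1 - K)` of the operator `K` on `L²(μ)` with kernel `k`, as the
sum of its Fredholm series. -/
def fredholmSum (k : α → α → ℝ) : ℝ := ∑' n, fredholmWeight n * fredholmCoeff μ k n

variable {k : α → α → ℝ} {φ ψ : α → ℝ} {M : ℝ}

theorem fredholmWeight_zero : fredholmWeight 0 = 1 := by simp [fredholmWeight]

theorem fredholmWeight_succ_mul (n : ℕ) : fredholmWeight (n + 1) * (n + 1) = -fredholmWeight n := by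
  rw [fredholmWeight, fredholmWeight, Nat.factorial_succ]
  push_cast
  field_simp
  ring

theorem abs_fredholmWeight (n : ℕ) : |fredholmWeight n| = 1 / n.factorial := by
  rw [fredholmWeight, abs_div, abs_pow, abs_neg, abs_one, one_pow, Nat.abs_cast]

theorem fredholmCoeff_zero : fredholmCoeff μ k 0 = 1 := by
  simp [fredholmCoeff, measureReal_def]

theorem borderedCoeff_zero (x : α) : borderedCoeff μ k ψ 0 x = ψ x := by
  simp [borderedCoeff, borderedMatrix_zero, measureReal_def]

theorem integrable_mul_kernel_mul (hk : Measurable (Function.uncurry k))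
    (hkM : ∀ x t, |k x t| ≤ M) {f g : α → ℝ} (hf : Integrable f μ) (hg : Integrable g μ) :
    Integrable (fun p : α × α => f p.1 * (k p.2 p.1 * g p.2)) (μ.prod μ) :=
  ((hf.mul_prod hg).bdd_mul (c := M) (hk.comp measurable_swap).aestronglyMeasurable
    (Filter.Eventually.of_forall fun p => hkM p.2 p.1)).congr
      (Filter.Eventually.of_forall fun _ => mul_left_comm _ _ _)

theorem integral_mul_integral_kernel_swap [SFinite μ] (hk : Measurable (Function.uncurry k))
    (hkM : ∀ x t, |k x t| ≤ M) {f g : α → ℝ} (hf : Integrable f μ) (hg : Integrable g μ) :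
    ∫ x, f x * ∫ t, k t x * g t ∂μ ∂μ = ∫ t, (∫ x, k t x * f x ∂μ) * g t ∂μ := by
  simp only [← integral_const_mul, ← integral_mul_const]
  rw [integral_integral_swap (integrable_mul_kernel_mul μ hk hkM hf hg)]
  congr! 4
  ring

variable [IsFiniteMeasure μ]

theorem abs_integral_pi_le {n : ℕ} {f : (Fin n → α) → ℝ} {C : ℝ} (hf : ∀ y, |f y| ≤ C) :
    |∫ y, f y ∂(Measure.pi fun _ : Fin n => μ)| ≤ C * μ.real univ ^ n := by
  have hvolume : (Measure.pi fun _ : Fin n => μ).real univ = μ.real univ ^ n := by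
    simp [Measure.real, Measure.pi_univ]
  rw [← hvolume]
  exact norm_integral_le_of_norm_le_const (f := f) (Filter.Eventually.of_forall hf)

theorem abs_fredholmCoeff_le (hkM : ∀ x t, |k x t| ≤ M) (n : ℕ) :
    |fredholmCoeff μ k n| ≤ (√n * (M * μ.real univ)) ^ n := by
  rw [← mul_assoc, mul_pow]
  exact abs_integral_pi_le μ (abs_det_kernelMatrix_le hkM)

theorem abs_borderedCoeff_le (hkM : ∀ x t, |k x t| ≤ M) (hψM : ∀ x, |ψ x| ≤ M) (n : ℕ) (x : α) :
    |borderedCoeff μ k ψ n x| ≤ (√(n + 1 : ℕ) * M) ^ (n + 1) * μ.real univ ^ n :=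
  abs_integral_pi_le μ (abs_det_borderedMatrix_le hkM hψM x)

theorem summable_fredholmSeries (hkM : ∀ x t, |k x t| ≤ M) :
    Summable fun n => fredholmWeight n * fredholmCoeff μ k n := by
  refine Summable.of_norm_bounded (summable_sqrt_mul_pow_div_factorial (M * μ.real univ))
    fun n => ?_
  rw [Real.norm_eq_abs, abs_mul, abs_fredholmWeight, one_div_mul_eq_div]
  gcongr
  exact abs_fredholmCoeff_le μ hkM n

theorem summable_borderedSeries_bound (M m : ℝ) :
    Summable fun n : ℕ => (√(n + 1 : ℕ) * M) ^ (n + 1) * m ^ n / n.factorial := by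
  have hmajorant := (summable_nat_add_iff 1).2
    (summable_sqrt_mul_pow_div_factorial (2 * |M| * (|m| + 1)))
  refine Summable.of_norm_bounded hmajorant fun n => ?_
  have htwo : ((n + 1 : ℕ) : ℝ) ≤ 2 ^ (n + 1) := by exact_mod_cast Nat.lt_two_pow_self.le
  have hm : |m| ^ n ≤ (|m| + 1) ^ (n + 1) :=
    (pow_le_pow_left₀ (abs_nonneg m) (by linarith) n).trans
      (pow_le_pow_right₀ (by linarith [abs_nonneg m]) (Nat.le_succ n))
  calc ‖(√(n + 1 : ℕ) * M) ^ (n + 1) * m ^ n / n.factorial‖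
      = (√(n + 1 : ℕ) * |M|) ^ (n + 1) * |m| ^ n * (n + 1 : ℕ) / (n + 1).factorial := by
        rw [Nat.factorial_succ, Real.norm_eq_abs, abs_div, abs_mul, abs_pow, abs_pow, abs_mul,
          abs_of_nonneg (Real.sqrt_nonneg _), Nat.abs_cast]
        push_cast
        field_simp
    _ ≤ (√(n + 1 : ℕ) * |M|) ^ (n + 1) * (|m| + 1) ^ (n + 1) * 2 ^ (n + 1) /
          (n + 1).factorial := by gcongr
    _ = (√(n + 1 : ℕ) * (2 * |M| * (|m| + 1))) ^ (n + 1) / (n + 1).factorial := by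
        rw [← mul_pow, ← mul_pow]
        ring_nf

section Bordered

variable (hk : Measurable (Function.uncurry k)) (hψ : Measurable ψ) (hkM : ∀ x t, |k x t| ≤ M)
  (hψM : ∀ x, |ψ x| ≤ M)
include hk hψ hkM hψM

theorem integrable_mul_det_borderedMatrix {g : α → ℝ} (hg : Measurable g) (hgM : ∀ x, |g x| ≤ M)
    (n : ℕ) :
    Integrable (fun p : α × (Fin n → α) => g p.1 * (borderedMatrix k ψ p.1 p.2).det)
      (μ.prod (Measure.pi fun _ : Fin n => μ)) := by
  refine Integrable.of_bound ((hg.comp measurable_fst).mul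
    (measurable_det_borderedMatrix hk hψ)).aestronglyMeasurable
    (M * (√(n + 1 : ℕ) * M) ^ (n + 1)) (Filter.Eventually.of_forall fun p => ?_)
  rw [norm_mul]
  exact mul_le_mul (hgM _) (abs_det_borderedMatrix_le hkM hψM _ _) (norm_nonneg _)
    ((abs_nonneg _).trans (hgM p.1))

theorem integral_sum_mul_det_borderedMatrix {g : α → ℝ} (hg : Measurable g)
    (hgM : ∀ x, |g x| ≤ M) (n : ℕ) :
    ∫ y, ∑ i, g (y i) * (borderedMatrix k ψ (y i) (i.removeNth y)).det
        ∂(Measure.pi fun _ : Fin (n + 1) => μ) =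
      (n + 1) * ∫ x, g x * borderedCoeff μ k ψ n x ∂μ := by
  refine (integral_sum_removeNth μ
    (integrable_mul_det_borderedMatrix μ hk hψ hkM hψM hg hgM n)).trans ?_
  simp only [integral_const_mul, borderedCoeff]

omit hkM hψM in
theorem aestronglyMeasurable_borderedCoeff (n : ℕ) :
    AEStronglyMeasurable (borderedCoeff μ k ψ n) μ :=
  ((measurable_det_borderedMatrix hk hψ).stronglyMeasurable.integral_prod_right
    (ν := Measure.pi fun _ : Fin n => μ)).aestronglyMeasurable

theorem integrable_borderedCoeff (n : ℕ) : Integrable (borderedCoeff μ k ψ n) μ :=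
  Integrable.of_bound (aestronglyMeasurable_borderedCoeff μ hk hψ n) _
    (Filter.Eventually.of_forall fun x => abs_borderedCoeff_le μ hkM hψM n x)

theorem integrable_mul_borderedCoeff {f : α → ℝ} (hf : Integrable f μ) (n : ℕ) :
    Integrable (fun x => f x * borderedCoeff μ k ψ n x) μ :=
  hf.mul_bdd (aestronglyMeasurable_borderedCoeff μ hk hψ n)
    (Filter.Eventually.of_forall fun x => abs_borderedCoeff_le μ hkM hψM n x)

theorem borderedCoeff_succ (n : ℕ) (x : α) :
    borderedCoeff μ k ψ (n + 1) x = ψ x * fredholmCoeff μ k (n + 1) -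
      (n + 1) * ∫ t, k t x * borderedCoeff μ k ψ n t ∂μ := by
  have hcolumn : Measurable fun t => k t x := hk.comp measurable_prodMk_right
  rw [← integral_sum_mul_det_borderedMatrix μ hk hψ hkM hψM hcolumn (fun t => hkM t x),
    fredholmCoeff, ← integral_const_mul, ← integral_sub, borderedCoeff]
  · simp only [det_borderedMatrix_succ]
  · exact (Integrable.of_bound (measurable_det_kernelMatrix hk).aestronglyMeasurable _
      (Filter.Eventually.of_forall (abs_det_kernelMatrix_le hkM))).const_mul _
  · exact integrable_finsetSum _ fun i _ =>
      (measurePreserving_piFinSuccAbove (fun _ : Fin (n + 1) => μ) i).integrable_comp_of_integrable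
        (integrable_mul_det_borderedMatrix μ hk hψ hkM hψM hcolumn (fun t => hkM t x) n)

theorem succ_mul_integral_mul_borderedCoeff {w : α → ℝ} (hφ : Integrable φ μ) (hw : Integrable w μ)
    (hwφ : ∀ x, w x = φ x + ∫ t, k x t * w t ∂μ) (n : ℕ) :
    (n + 1) * ∫ x, φ x * borderedCoeff μ k ψ n x ∂μ =
      (n + 1) * (∫ x, w x * borderedCoeff μ k ψ n x ∂μ)
        - (∫ x, w x * ψ x ∂μ) * fredholmCoeff μ k (n + 1)
        + ∫ x, w x * borderedCoeff μ k ψ (n + 1) x ∂μ := by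
  have hBint := integrable_borderedCoeff μ hk hψ hkM hψM n
  have hwψ : Integrable (fun x => w x * ψ x) μ :=
    hw.mul_bdd hψ.aestronglyMeasurable (Filter.Eventually.of_forall hψM)
  have hwK : Integrable (fun x => w x * ∫ t, k t x * borderedCoeff μ k ψ n t ∂μ) μ := by
    simpa only [integral_const_mul] using
      (integrable_mul_kernel_mul μ hk hkM hw hBint).integral_prod_left
  have hadjoint : ∫ x, w x * ∫ t, k t x * borderedCoeff μ k ψ n t ∂μ ∂μ =
      (∫ x, w x * borderedCoeff μ k ψ n x ∂μ) - ∫ x, φ x * borderedCoeff μ k ψ n x ∂μ := by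
    rw [integral_mul_integral_kernel_swap μ hk hkM hw hBint,
      ← integral_sub (integrable_mul_borderedCoeff μ hk hψ hkM hψM hw n)
        (integrable_mul_borderedCoeff μ hk hψ hkM hψM hφ n)]
    congr! 2 with t
    rw [hwφ t]
    ring
  have hrecursion : ∫ x, w x * borderedCoeff μ k ψ (n + 1) x ∂μ =
      (∫ x, w x * ψ x ∂μ) * fredholmCoeff μ k (n + 1) -
        (n + 1) * ∫ x, w x * ∫ t, k t x * borderedCoeff μ k ψ n t ∂μ ∂μ := by
    rw [← integral_mul_const, ← integral_const_mul,
      ← integral_sub (hwψ.mul_const _) (hwK.const_mul _)]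
    congr! 2 with x
    rw [borderedCoeff_succ μ hk hψ hkM hψM]
    ring
  rw [hrecursion, hadjoint]
  ring

omit hk hψ in
theorem abs_integral_mul_borderedCoeff_le {f : α → ℝ} (hf : Integrable f μ) (n : ℕ) :
    |∫ x, f x * borderedCoeff μ k ψ n x ∂μ| ≤
      (∫ x, |f x| ∂μ) * ((√(n + 1 : ℕ) * M) ^ (n + 1) * μ.real univ ^ n) := by
  rw [← integral_mul_const]
  refine norm_integral_le_of_norm_le (f := fun x => f x * borderedCoeff μ k ψ n x)
    (hf.abs.mul_const _) (Filter.Eventually.of_forall fun x => ?_)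
  rw [Real.norm_eq_abs, abs_mul]
  exact mul_le_mul_of_nonneg_left (abs_borderedCoeff_le μ hkM hψM n x) (abs_nonneg _)

omit hk hψ in
theorem summable_weight_mul_integral_mul_borderedCoeff {f : α → ℝ} (hf : Integrable f μ) :
    Summable fun n => fredholmWeight n * ∫ x, f x * borderedCoeff μ k ψ n x ∂μ := by
  refine Summable.of_norm_bounded
    ((summable_borderedSeries_bound M (μ.real univ)).mul_left (∫ x, |f x| ∂μ)) fun n => ?_
  rw [Real.norm_eq_abs, abs_mul, abs_fredholmWeight, one_div_mul_eq_div, mul_div_assoc']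
  gcongr
  exact abs_integral_mul_borderedCoeff_le μ hkM hψM hf n

theorem tsum_weight_mul_integral_mul_borderedCoeff {w : α → ℝ} (hφ : Integrable φ μ)
    (hw : Integrable w μ) (hwφ : ∀ x, w x = φ x + ∫ t, k x t * w t ∂μ) :
    ∑' n, fredholmWeight n * ∫ x, φ x * borderedCoeff μ k ψ n x ∂μ =
      (∫ x, w x * ψ x ∂μ) * fredholmSum μ k := by
  have hF := summable_fredholmSeries μ hkM
  have hB := summable_weight_mul_integral_mul_borderedCoeff μ hkM hψM hw
  have hterm : ∀ n : ℕ, fredholmWeight n * ∫ x, φ x * borderedCoeff μ k ψ n x ∂μ =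
      fredholmWeight n * (∫ x, w x * borderedCoeff μ k ψ n x ∂μ)
        - fredholmWeight (n + 1) * (∫ x, w x * borderedCoeff μ k ψ (n + 1) x ∂μ)
        + (∫ x, w x * ψ x ∂μ) * (fredholmWeight (n + 1) * fredholmCoeff μ k (n + 1)) := by
    intro n
    have hsucc := succ_mul_integral_mul_borderedCoeff μ hk hψ hkM hψM hφ hw hwφ n
    linear_combination -fredholmWeight (n + 1) * hsucc + ((∫ x, φ x * borderedCoeff μ k ψ n x ∂μ) -
      ∫ x, w x * borderedCoeff μ k ψ n x ∂μ) * fredholmWeight_succ_mul n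
  have hF1 := (summable_nat_add_iff 1).2 hF
  have hB1 := (summable_nat_add_iff 1).2 hB
  rw [tsum_congr hterm, (hB.sub hB1).tsum_add (hF1.mul_left _), hB.tsum_sub hB1, tsum_mul_left,
    fredholmSum, hB.tsum_eq_zero_add, hF.tsum_eq_zero_add]
  simp only [fredholmCoeff_zero, borderedCoeff_zero, fredholmWeight_zero]
  ring

end Bordered

end FredholmSeries

section RankOneDerivative

variable {α : Type*} [MeasurableSpace α] (μ : Measure α) [IsFiniteMeasure μ]
  {k : ℝ → α → α → ℝ} {φ ψ : ℝ → α → ℝ} {M : ℝ} {U : Set ℝ}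
  (hk : ∀ z, Measurable (Function.uncurry (k z))) (hφ : ∀ z, Measurable (φ z))
  (hψ : ∀ z, Measurable (ψ z)) (hU : IsOpen U) (hkM : ∀ z ∈ U, ∀ x t, |k z x t| ≤ M)
  (hφM : ∀ z ∈ U, ∀ x, |φ z x| ≤ M) (hψM : ∀ z ∈ U, ∀ x, |ψ z x| ≤ M)

omit [MeasurableSpace α] in
theorem hasDerivAt_det_kernelMatrix {z : ℝ}
    (hd : ∀ x t, HasDerivAt (fun z => k z x t) (φ z x * ψ z t) z) {n : ℕ} (y : Fin (n + 1) → α) :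
    HasDerivAt (fun z => (kernelMatrix (k z) y).det)
      (∑ i, φ z (y i) * (borderedMatrix (k z) (ψ z) (y i) (i.removeNth y)).det) z := by
  convert! hasDerivAt_det (A := fun z => kernelMatrix (k z) y)
    (A' := Matrix.of fun i j => φ z (y i) * ψ z (y j)) fun i j => hd (y i) (y j) using 1
  refine Finset.sum_congr rfl fun i _ => ?_
  rw [← det_updateRow_kernelMatrix, ← Matrix.det_updateRow_smul]
  rfl

include hk hφ hψ hU hkM hφM hψM

theorem hasDerivAt_fredholmCoeff_succ
    (hd : ∀ z ∈ U, ∀ x t, HasDerivAt (fun z => k z x t) (φ z x * ψ z t) z) {z : ℝ} (hz : z ∈ U)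
    (n : ℕ) :
    HasDerivAt (fun z => fredholmCoeff μ (k z) (n + 1))
      ((n + 1) * ∫ x, φ z x * borderedCoeff μ (k z) (ψ z) n x ∂μ) z := by
  have hderiv_le : ∀ z ∈ U, ∀ y : Fin (n + 1) → α,
      |∑ i, φ z (y i) * (borderedMatrix (k z) (ψ z) (y i) (i.removeNth y)).det| ≤
        ∑ _i : Fin (n + 1), M * (√(n + 1 : ℕ) * M) ^ (n + 1) := fun z hz y =>
    (Finset.abs_sum_le_sum_abs _ _).trans <| Finset.sum_le_sum fun i _ => by
      rw [abs_mul]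
      exact mul_le_mul (hφM z hz _) (abs_det_borderedMatrix_le (hkM z hz) (hψM z hz) _ _)
        (abs_nonneg _) ((abs_nonneg _).trans (hφM z hz (y i)))
  have hderiv_meas : Measurable fun y : Fin (n + 1) → α =>
      ∑ i, φ z (y i) * (borderedMatrix (k z) (ψ z) (y i) (i.removeNth y)).det :=
    Finset.measurable_fun_sum _ fun i _ => ((hφ z).comp (measurable_pi_apply i)).mul
      ((measurable_det_borderedMatrix (hk z) (hψ z)).comp
        (MeasurableEquiv.piFinSuccAbove (fun _ : Fin (n + 1) => α) i).measurable)
  rw [← integral_sum_mul_det_borderedMatrix μ (hk z) (hψ z) (hkM z hz) (hψM z hz) (hφ z) (hφM z hz)]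
  refine (hasDerivAt_integral_of_dominated_loc_of_deriv_le (hU.mem_nhds hz)
    (F := fun z y => (kernelMatrix (k z) y).det) ?_ ?_ hderiv_meas.aestronglyMeasurable
    (Filter.Eventually.of_forall fun y z hz => hderiv_le z hz y) (integrable_const _)
    (Filter.Eventually.of_forall fun y z hz => hasDerivAt_det_kernelMatrix (hd z hz) y)).2
  · exact Filter.Eventually.of_forall fun z =>
      (measurable_det_kernelMatrix (hk z)).aestronglyMeasurable
  · exact Integrable.of_bound (measurable_det_kernelMatrix (hk z)).aestronglyMeasurable _
      (Filter.Eventually.of_forall (abs_det_kernelMatrix_le (hkM z hz)))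

theorem hasDerivAt_fredholmTerm_succ
    (hd : ∀ z ∈ U, ∀ x t, HasDerivAt (fun z => k z x t) (φ z x * ψ z t) z) {z : ℝ} (hz : z ∈ U)
    (n : ℕ) :
    HasDerivAt (fun z => fredholmWeight (n + 1) * fredholmCoeff μ (k z) (n + 1))
      (-(fredholmWeight n * ∫ x, φ z x * borderedCoeff μ (k z) (ψ z) n x ∂μ)) z := by
  refine ((hasDerivAt_fredholmCoeff_succ μ hk hφ hψ hU hkM hφM hψM hd hz n).const_mul
    (fredholmWeight (n + 1))).congr_deriv ?_
  rw [← mul_assoc, fredholmWeight_succ_mul, neg_mul]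

omit hk hψ hU in
theorem abs_weight_mul_integral_mul_borderedCoeff_le {z : ℝ} (hz : z ∈ U) (n : ℕ) :
    |fredholmWeight n * ∫ x, φ z x * borderedCoeff μ (k z) (ψ z) n x ∂μ| ≤
      M * μ.real univ * ((√(n + 1 : ℕ) * M) ^ (n + 1) * μ.real univ ^ n / n.factorial) := by
  rcases isEmpty_or_nonempty α with hα | ⟨⟨x⟩⟩
  · simp [Measure.eq_zero_of_isEmpty μ]
  have hM : 0 ≤ M := (abs_nonneg _).trans (hφM z hz x)
  have hφint : Integrable (φ z) μ := Integrable.of_bound (hφ z).aestronglyMeasurable M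
    (Filter.Eventually.of_forall (hφM z hz))
  have hφnorm : ∫ x, |φ z x| ∂μ ≤ M * μ.real univ := by
    rw [mul_comm, ← smul_eq_mul, ← integral_const]
    exact integral_mono hφint.abs (integrable_const _) (hφM z hz)
  rw [abs_mul, abs_fredholmWeight, one_div_mul_eq_div, mul_div_assoc']
  gcongr
  refine (abs_integral_mul_borderedCoeff_le μ (hkM z hz) (hψM z hz) hφint n).trans ?_
  gcongr

theorem hasDerivAt_fredholmSum (hUconn : IsPreconnected U)
    (hd : ∀ z ∈ U, ∀ x t, HasDerivAt (fun z => k z x t) (φ z x * ψ z t) z) {z : ℝ} (hz : z ∈ U)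
    {w : α → ℝ} (hw : Integrable w μ) (hwφ : ∀ x, w x = φ z x + ∫ t, k z x t * w t ∂μ) :
    HasDerivAt (fun z => fredholmSum μ (k z))
      (-((∫ x, w x * ψ z x ∂μ) * fredholmSum μ (k z))) z := by
  have hφint : Integrable (φ z) μ := Integrable.of_bound (hφ z).aestronglyMeasurable M
    (Filter.Eventually.of_forall (hφM z hz))
  have htail : HasDerivAt
      (fun z => ∑' n, fredholmWeight (n + 1) * fredholmCoeff μ (k z) (n + 1))
      (∑' n, -(fredholmWeight n * ∫ x, φ z x * borderedCoeff μ (k z) (ψ z) n x ∂μ)) z :=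
    hasDerivAt_tsum_of_isPreconnected
      ((summable_borderedSeries_bound M (μ.real univ)).mul_left (M * μ.real univ)) hU hUconn
      (fun n z hz => hasDerivAt_fredholmTerm_succ μ hk hφ hψ hU hkM hφM hψM hd hz n)
      (fun n z hz => (norm_neg _).trans_le
        (abs_weight_mul_integral_mul_borderedCoeff_le μ hφ hkM hφM hψM hz n)) hz
      ((summable_nat_add_iff 1).2 (summable_fredholmSeries μ (hkM z hz))) hz
  rw [tsum_neg, tsum_weight_mul_integral_mul_borderedCoeff μ (hk z) (hψ z) (hkM z hz) (hψM z hz)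
    hφint hw hwφ] at htail
  refine (htail.const_add 1).congr_of_eventuallyEq ?_
  filter_upwards [hU.mem_nhds hz] with y hy
  rw [fredholmSum, (summable_fredholmSeries μ (hkM y hy)).tsum_eq_zero_add, fredholmCoeff_zero,
    fredholmWeight_zero, one_mul]

end RankOneDerivative

section Resolvent

variable {L : ℝ} {k q : ℝ → ℝ → ℝ} {f g : ℝ → ℂ}

theorem continuousOn_intOp (hL : 0 ≤ L)
    (hk : ContinuousOn (fun p : ℝ × ℝ => k p.1 p.2) (Icc (-L) L ×ˢ Icc (-L) L))
    (hf : IntervalIntegrable f volume (-L) L) : ContinuousOn (intOp L k f) (Icc (-L) L) := by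
  have hLL : -L ≤ L := by linarith
  obtain ⟨C, hC⟩ := (isCompact_Icc.prod isCompact_Icc).exists_bound_of_continuousOn hk
  have hrow : ∀ x ∈ Icc (-L) L, ContinuousOn (k x) (Icc (-L) L) := fun x hx =>
    hk.comp (f := fun t => (x, t)) (by fun_prop) fun t ht => ⟨hx, ht⟩
  intro x hx
  refine intervalIntegral.continuousWithinAt_of_dominated_interval (bound := fun t => C * ‖f t‖)
    ?_ ?_ (hf.norm.const_mul C) ?_
  · filter_upwards [self_mem_nhdsWithin] with y hy
    refine AEStronglyMeasurable.mul ?_ hf.def'.aestronglyMeasurable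
    rw [uIoc_of_le hLL]
    exact ((Complex.continuous_ofReal.comp_continuousOn (hrow y hy)).mono
      Ioc_subset_Icc_self).aestronglyMeasurable measurableSet_Ioc
  · filter_upwards [self_mem_nhdsWithin] with y hy
    refine Filter.Eventually.of_forall fun t ht => ?_
    rw [uIoc_of_le hLL] at ht
    rw [norm_mul, Complex.norm_real]
    gcongr
    exact hC (y, t) ⟨hy, Ioc_subset_Icc_self ht⟩
  · refine Filter.Eventually.of_forall fun t ht => ?_
    rw [uIoc_of_le hLL] at ht
    have hcolumn : ContinuousOn (fun y => k y t) (Icc (-L) L) :=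
      hk.comp (f := fun y => (y, t)) (by fun_prop) fun y hy => ⟨hy, Ioc_subset_Icc_self ht⟩
    exact (Complex.continuous_ofReal.comp_continuousOn hcolumn).mul continuousOn_const x hx

theorem intervalIntegrable_intOp (hL : 0 ≤ L)
    (hk : ContinuousOn (fun p : ℝ × ℝ => k p.1 p.2) (Icc (-L) L ×ˢ Icc (-L) L))
    (hf : IntervalIntegrable f volume (-L) L) :
    IntervalIntegrable (intOp L k f) volume (-L) L :=
  (continuousOn_intOp hL hk hf).intervalIntegrable_of_Icc (by linarith)

theorem intervalIntegrable_kernel_mul (hk : Continuous (Function.uncurry k))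
    (hf : IntervalIntegrable f volume (-L) L) (x : ℝ) :
    IntervalIntegrable (fun t => (k x t : ℂ) * f t) volume (-L) L :=
  have hrow : Continuous (k x) := hk.comp (by fun_prop : Continuous fun t : ℝ => (x, t))
  hf.continuousOn_mul (by fun_prop)

theorem intOp_add (hk : Continuous (Function.uncurry k)) (hf : IntervalIntegrable f volume (-L) L)
    (hg : IntervalIntegrable g volume (-L) L) (x : ℝ) :
    intOp L k (fun y => f y + g y) x = intOp L k f x + intOp L k g x := by
  simp only [intOp, mul_add]
  exact intervalIntegral.integral_add (intervalIntegrable_kernel_mul hk hf x)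
    (intervalIntegrable_kernel_mul hk hg x)

theorem intOp_sub (hk : Continuous (Function.uncurry k)) (hf : IntervalIntegrable f volume (-L) L)
    (hg : IntervalIntegrable g volume (-L) L) (x : ℝ) :
    intOp L k (fun y => f y - g y) x = intOp L k f x - intOp L k g x := by
  simp only [intOp, mul_sub]
  exact intervalIntegral.integral_sub (intervalIntegrable_kernel_mul hk hf x)
    (intervalIntegrable_kernel_mul hk hg x)

theorem intOp_congr (hL : 0 ≤ L) (h : EqOn f g (Icc (-L) L)) (x : ℝ) :
    intOp L k f x = intOp L k g x :=
  intervalIntegral.integral_congr fun t ht => by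
    rw [uIcc_of_le (by linarith)] at ht
    simp only [h ht]

theorem integrable_kernel_mul_kernel_mul (hL : 0 ≤ L) (hk : Continuous (Function.uncurry k))
    (hq : Continuous (Function.uncurry q)) (hf : IntervalIntegrable f volume (-L) L) (x : ℝ) :
    Integrable (Function.uncurry fun s t => ((k x s * q s t : ℝ) : ℂ) * f t)
      ((volume.restrict (Ioc (-L) L)).prod (volume.restrict (Ioc (-L) L))) := by
  have hkq : Continuous fun p : ℝ × ℝ => ((k x p.1 * q p.1 p.2 : ℝ) : ℂ) :=
    Complex.continuous_ofReal.comp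
      ((hk.comp (by fun_prop : Continuous fun p : ℝ × ℝ => (x, p.1))).mul hq)
  obtain ⟨C, hC⟩ := (isCompact_Icc.prod isCompact_Icc).exists_bound_of_continuousOn
    (s := Icc (-L) L ×ˢ Icc (-L) L) hkq.continuousOn
  refine (((intervalIntegrable_iff_integrableOn_Ioc_of_le (by linarith)).1 hf).comp_snd _).bdd_mul
    (c := C) hkq.aestronglyMeasurable ?_
  rw [Measure.prod_restrict]
  filter_upwards [ae_restrict_mem (measurableSet_Ioc.prod measurableSet_Ioc)] with p hp
  exact hC p ⟨Ioc_subset_Icc_self hp.1, Ioc_subset_Icc_self hp.2⟩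

theorem intOp_intOp (hL : 0 ≤ L) (hk : Continuous (Function.uncurry k))
    (hq : Continuous (Function.uncurry q)) (hf : IntervalIntegrable f volume (-L) L) (x : ℝ) :
    intOp L k (intOp L q f) x = intOp L (fun x t => ∫ s in (-L)..L, k x s * q s t) f x := by
  simp only [intOp, ← intervalIntegral.integral_ofReal, ← intervalIntegral.integral_const_mul,
    ← intervalIntegral.integral_mul_const]
  simp only [intervalIntegral.integral_of_le (show -L ≤ L by linarith), ← mul_assoc,
    ← Complex.ofReal_mul]
  exact integral_integral_swap (integrable_kernel_mul_kernel_mul hL hk hq hf x)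

theorem intOp_add_intOp_resolvent (hL : 0 ≤ L) (hk : Continuous (Function.uncurry k))
    (hq : Continuous (Function.uncurry q))
    (hqk : ∀ x t, q x t = k x t + ∫ s in (-L)..L, k x s * q s t)
    (hf : IntervalIntegrable f volume (-L) L) (x : ℝ) :
    intOp L k (fun y => f y + intOp L q f y) x = intOp L q f x := by
  have hcomp : intOp L (fun x t => ∫ s in (-L)..L, k x s * q s t) f x =
      intOp L q f x - intOp L k f x := by
    rw [intOp, intOp, intOp, ← intervalIntegral.integral_sub (intervalIntegrable_kernel_mul hq hf x)
      (intervalIntegrable_kernel_mul hk hf x)]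
    congr! 2 with t
    rw [hqk x t]
    push_cast
    ring
  rw [intOp_add hk hf (intervalIntegrable_intOp hL hq.continuousOn hf), intOp_intOp hL hk hq hf,
    hcomp]
  ring

section Inverse

variable (hL : 0 ≤ L) (hk : Continuous (Function.uncurry k))
  (hinj : ∀ f : ℝ → ℂ, ContinuousOn f (Icc (-L) L) → EqOn f (intOp L k f) (Icc (-L) L) →
    EqOn f 0 (Icc (-L) L))
include hL hk hinj

theorem exists_continuous_resolvent :
    ∃ q : ℝ → ℝ → ℝ, Continuous (Function.uncurry q) ∧
      ∀ x t, q x t = k x t + ∫ s in (-L)..L, k x s * q s t := by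
  have hinj_real : ∀ f : ℝ → ℝ, Continuous f →
      (∀ x ∈ Icc (-L) L, f x = ∫ t in (-L)..L, k x t * f t) → ∀ x ∈ Icc (-L) L, f x = 0 := by
    intro f hf hfk x hx
    refine Complex.ofReal_eq_zero.1 (hinj (fun t => f t) (by fun_prop) (fun y hy => ?_) hx)
    simp only [hfk y hy, intOp, ← intervalIntegral.integral_ofReal, Complex.ofReal_mul]
  obtain ⟨w, hw, hwk⟩ := exists_solution (Z := ℝ) (a := -L) (b := L) (by linarith)
    (k := fun _ => k) (φ := fun t x => k x t)
    (hk.comp (by fun_prop : Continuous fun p : ℝ × ℝ × ℝ => p.2))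
    (hk.comp (by fun_prop : Continuous fun p : ℝ × ℝ => (p.2, p.1))) fun _ => hinj_real
  exact ⟨fun x t => w t x, hw.comp (by fun_prop : Continuous fun p : ℝ × ℝ => (p.2, p.1)),
    fun x t => hwk t x⟩

theorem intOp_resolvent_sub_intOp (hq : Continuous (Function.uncurry q))
    (hqk : ∀ x t, q x t = k x t + ∫ s in (-L)..L, k x s * q s t)
    (hf : IntervalIntegrable f volume (-L) L) :
    EqOn (intOp L q fun y => f y - intOp L k f y) (intOp L k f) (Icc (-L) L) := by
  set h : ℝ → ℂ := fun y => f y - intOp L k f y with h_def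
  have hh : IntervalIntegrable h volume (-L) L :=
    hf.sub (intervalIntegrable_intOp hL hk.continuousOn hf)
  -- With `u = h + Q h`, the difference `u - f = Q h - K f` is a continuous fixed point of `K`.
  have hfixed : EqOn (fun x => intOp L q h x - intOp L k f x)
      (intOp L k fun x => intOp L q h x - intOp L k f x) (Icc (-L) L) := by
    intro x _
    have hdiff : (fun y => intOp L q h y - intOp L k f y) =
        fun y => (h y + intOp L q h y) - f y := by
      funext y
      rw [h_def]
      ring
    rw [hdiff, intOp_sub hk (hh.add (intervalIntegrable_intOp hL hq.continuousOn hh)) hf,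
      intOp_add_intOp_resolvent hL hk hq hqk hh, ← hdiff]
  exact fun x hx => sub_eq_zero.1 (hinj _ ((continuousOn_intOp hL hq.continuousOn hh).sub
    (continuousOn_intOp hL hk.continuousOn hf)) hfixed hx)

theorem exists_isResolventKernel : ∃ q, IsResolventKernel L k q := by
  obtain ⟨q, hq, hqk⟩ := exists_continuous_resolvent hL hk hinj
  refine ⟨q, hq.continuousOn, fun f hf2 => ?_⟩
  have hf : IntervalIntegrable f volume (-L) L :=
    (intervalIntegrable_iff_integrableOn_Ioc_of_le (by linarith)).2 (hf2.integrable one_le_two)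
  constructor
  · refine Filter.Eventually.of_forall fun x => ?_
    simp only [intOp_add_intOp_resolvent hL hk hq hqk hf, add_sub_cancel_right]
  · filter_upwards [ae_restrict_mem measurableSet_Ioc] with x hx
    rw [intOp_resolvent_sub_intOp hL hk hinj hq hqk hf (Ioc_subset_Icc_self hx), sub_add_cancel]

end Inverse

theorem IsResolventKernel.eqOn_add_intOp (hL : 0 < L) (hq : IsResolventKernel L k q)
    {U : ℝ → ℂ} (hU : ContinuousOn U (Icc (-L) L)) (hf : ContinuousOn f (Icc (-L) L))
    (hUf : EqOn U (fun x => f x + intOp L k U x) (Icc (-L) L)) :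
    EqOn U (fun x => f x + intOp L q f x) (Icc (-L) L) := by
  have hLL : -L < L := by linarith
  have hU2 : MemLp U 2 (volume.restrict (Ioc (-L) L)) :=
    (memLp_indicator_iff_restrict measurableSet_Ioc).1 (memLp_indicator_Ioc hU 2)
  refine Measure.eqOn_Icc_of_ae_eq volume hLL.ne ?_ hU
    (hf.add (continuousOn_intOp hL.le hq.1 (hf.intervalIntegrable_of_Icc hLL.le)))
  rw [← restrict_Ioc_eq_restrict_Icc]
  have hsub : EqOn (fun x => U x - intOp L k U x) f (Icc (-L) L) := fun x hx =>
    sub_eq_of_eq_add (hUf hx)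
  filter_upwards [(hq.2 U hU2).2, ae_restrict_mem measurableSet_Ioc] with x hx hxL
  rw [← hx, intOp_congr hL.le hsub, ← hsub (Ioc_subset_Icc_self hxL)]

theorem continuous_sineKernel : Continuous (Function.uncurry sineKernel) :=
  continuous_sineFun.comp (by fun_prop : Continuous fun p : ℝ × ℝ => ((1 : ℝ), p.1 - p.2))

theorem isResolventKernel_Q (hL : 0 < L) : IsResolventKernel L sineKernel (Q L) := by
  have hex : ∃ q, IsResolventKernel L sineKernel q :=
    exists_isResolventKernel hL.le continuous_sineKernel fun f hf hfk =>
      eqOn_zero_of_eq_integral_sineFun hf (by linarith) hfk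
  rw [Q, dif_pos hex]
  exact hex.choose_spec

end Resolvent

section Variation

variable {k : ℝ → ℝ → ℝ} {g : ℝ → ℝ}

theorem integral_mul_eq_sub_integral_integral (hk : Continuous (Function.uncurry k))
    {a b c d : ℝ} {u v : ℝ → ℝ} (hu : Continuous u) (hv : Continuous v)
    (hvg : ∀ x, v x = g x + ∫ t in c..d, k x t * v t) :
    ∫ x in a..b, u x * g x =
      (∫ x in a..b, u x * v x) - ∫ x in a..b, ∫ t in c..d, u x * (k x t * v t) := by
  have hF : Continuous (Function.uncurry fun x t => u x * (k x t * v t)) :=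
    (hu.comp continuous_fst).mul (hk.mul (hv.comp continuous_snd))
  have huv : Continuous fun x => u x * v x := hu.mul hv
  rw [← intervalIntegral.integral_sub (huv.intervalIntegrable _ _)
    ((intervalIntegral.continuous_parametric_intervalIntegral_of_continuous' hF
      c d).intervalIntegrable _ _)]
  refine intervalIntegral.integral_congr fun x _ => ?_
  simp only [intervalIntegral.integral_const_mul, hvg x]
  ring

theorem integral_mul_sub_integral_mul (hk : Continuous (Function.uncurry k))
    (hsymm : ∀ x t, k x t = k t x) {a b c d : ℝ} {u v : ℝ → ℝ} (hu : Continuous u)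
    (hv : Continuous v) (hug : ∀ x, u x = g x + ∫ t in a..b, k x t * u t)
    (hvg : ∀ x, v x = g x + ∫ t in c..d, k x t * v t) :
    (∫ x in a..b, u x * g x) - ∫ x in c..d, v x * g x =
      (∫ x in a..b, u x * v x) - ∫ x in c..d, u x * v x := by
  have hswap : ∫ x in a..b, ∫ t in c..d, u x * (k x t * v t) =
      ∫ t in c..d, ∫ x in a..b, v t * (k t x * u x) := by
    rw [integral_integral_swap_of_continuousOn (F := fun x t => u x * (k x t * v t))
      ((hu.comp continuous_fst).mul (hk.mul (hv.comp continuous_snd))).continuousOn]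
    simp only [hsymm, mul_comm, mul_left_comm]
  rw [integral_mul_eq_sub_integral_integral hk hu hv hvg,
    integral_mul_eq_sub_integral_integral hk hv hu hug, hswap, sub_sub_sub_cancel_right]
  simp only [mul_comm]

theorem integral_neg_sub_integral_neg {f : ℝ → ℝ} (hf : Continuous f) (y z : ℝ) :
    (∫ x in (-y)..y, f x) - ∫ x in (-z)..z, f x = ∫ x in z..y, (f x + f (-x)) := by
  have hint : ∀ a b, IntervalIntegrable f volume a b := fun a b => hf.intervalIntegrable a b
  have hneg : Continuous fun x => f (-x) := by fun_prop
  rw [intervalIntegral.integral_add (hint _ _) (hneg.intervalIntegrable _ _),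
    intervalIntegral.integral_comp_neg,
    intervalIntegral.integral_interval_sub_interval_comm' (hint _ _) (hint _ _) (hint _ _),
    sub_eq_add_neg, ← intervalIntegral.integral_symm]

theorem hasDerivAt_integral_of_continuousAt {E : Type*} [NormedAddCommGroup E] [NormedSpace ℝ E]
    [CompleteSpace E] {F : ℝ → ℝ → E} {z : ℝ} (hF : ContinuousAt (Function.uncurry F) (z, z))
    (hint : ∀ᶠ y in nhds z, IntervalIntegrable (F y) volume z y) :
    HasDerivAt (fun y => ∫ x in z..y, F y x) (F z z) z := by
  rw [hasDerivAt_iff_isLittleO, Asymptotics.isLittleO_iff]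
  intro c hc
  obtain ⟨δ, hδ, hFδ⟩ := Metric.continuousAt_iff.1 hF c hc
  filter_upwards [hint, Metric.ball_mem_nhds z hδ] with y hyint hy
  have hdiff : (∫ x in z..y, F y x) - (∫ x in z..z, F z x) - (y - z) • F z z =
      ∫ x in z..y, (F y x - F z z) := by
    rw [intervalIntegral.integral_same, sub_zero, intervalIntegral.integral_sub hyint (by simp),
      intervalIntegral.integral_const]
  rw [hdiff]
  refine intervalIntegral.norm_integral_le_of_norm_le_const fun x hx => ?_
  have hxz : dist x z ≤ dist y z := abs_sub_left_of_mem_uIcc (uIoc_subset_uIcc hx)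
  rw [← dist_eq_norm]
  exact (hFδ (x := (y, x)) (max_lt hy (hxz.trans_lt hy))).le

theorem hasDerivAt_integral_solution_mul (hk : Continuous (Function.uncurry k))
    (hsymm : ∀ x t, k x t = k t x) {W : ℝ → ℝ → ℝ} {z : ℝ} (hWc : ∀ y, Continuous (W y))
    (hWpos : ContinuousAt (Function.uncurry W) (z, z))
    (hWneg : ContinuousAt (Function.uncurry W) (z, -z))
    (hW : ∀ᶠ y in nhds z, ∀ x, W y x = g x + ∫ t in (-y)..y, k x t * W y t) :
    HasDerivAt (fun y => ∫ x in (-y)..y, W y x * g x) (W z z ^ 2 + W z (-z) ^ 2) z := by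
  have hcont : ∀ y, Continuous fun x => W y x * W z x + W y (-x) * W z (-x) := fun y => by
    have := hWc y
    have := hWc z
    fun_prop
  have hdiag : ContinuousAt
      (Function.uncurry fun y x => W y x * W z x + W y (-x) * W z (-x)) (z, z) := by
    have hneg : ContinuousAt (fun p : ℝ × ℝ => W p.1 (-p.2)) (z, z) :=
      ContinuousAt.comp (f := fun p : ℝ × ℝ => (p.1, -p.2)) (x := (z, z)) hWneg (by fun_prop)
    have hsnd : ContinuousAt (fun p : ℝ × ℝ => W z p.2) (z, z) :=
      ((hWc z).comp continuous_snd).continuousAt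
    have hsnd_neg : ContinuousAt (fun p : ℝ × ℝ => W z (-p.2)) (z, z) :=
      ((hWc z).comp continuous_snd.neg).continuousAt
    exact (hWpos.mul hsnd).add (hneg.mul hsnd_neg)
  have hderiv := (hasDerivAt_integral_of_continuousAt hdiag
    (Filter.Eventually.of_forall fun y => (hcont y).intervalIntegrable _ _)).const_add
      (∫ x in (-z)..z, W z x * g x)
  simp only [← sq] at hderiv
  refine hderiv.congr_of_eventuallyEq ?_
  filter_upwards [hW] with y hy
  rw [← integral_neg_sub_integral_neg (f := fun x => W y x * W z x) ((hWc y).mul (hWc z)),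
    ← integral_mul_sub_integral_mul hk hsymm (hWc y) (hWc z) hy hW.self_of_nhds]
  ring

end Variation

/-- `w z` solves the integral equation on `[-1, 1]` with the kernel `kPM ε z` and the right-hand
side `x ↦ trigPM ε (z * x)`, for every `z`, and depends continuously on `z`. The equation is asked
for at all real `x`, which extends the solution beyond `[-1, 1]`. -/
structure IsTrigSolution (ε : ℝ) (w : ℝ → ℝ → ℝ) : Prop where
  continuous : Continuous (Function.uncurry w)
  eq_add_integral (z x : ℝ) : w z x = trigPM ε (z * x) + ∫ t in (-1 : ℝ)..1, kPM ε z x t * w z t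

theorem exists_isTrigSolution {ε : ℝ} (hε : ε = 1 ∨ ε = -1) : ∃ w, IsTrigSolution ε w := by
  obtain ⟨w, hw, hwφ⟩ := exists_solution (a := -1) (b := 1) (φ := fun z x => trigPM ε (z * x))
    (by norm_num) (continuous_kPM ε)
    ((continuous_trigPM ε).comp continuous_mul)
    fun _ _ hf h => eqOn_zero_of_eq_integral_kPM hε hf.continuousOn h
  exact ⟨w, hw, hwφ⟩

namespace IsTrigSolution

/-- The pairing `⟨w z, φ z⟩` on `[-1, 1]` of the solution `w z` of the integral equation with its
right-hand side `φ z x = trigPM ε (z * x)`. -/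
def pairing (ε : ℝ) (w : ℝ → ℝ → ℝ) (z : ℝ) : ℝ := ∫ x in (-1 : ℝ)..1, w z x * trigPM ε (z * x)

variable {ε : ℝ} {w : ℝ → ℝ → ℝ}

theorem mul_pairing {z : ℝ} (hz : z ≠ 0) :
    z * pairing ε w z = ∫ x in (-z)..z, w z (x / z) * trigPM ε x := by
  have hsubst := intervalIntegral.mul_integral_comp_mul_left (a := -1) (b := 1)
    (f := fun x => w z (x / z) * trigPM ε x) z
  rw [mul_neg, mul_one] at hsubst
  simp only [← hsubst, pairing, mul_div_cancel_left₀ _ hz]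

variable (hw : IsTrigSolution ε w)
include hw

theorem continuous_scaled (z : ℝ) : Continuous fun x => w z (x / z) :=
  hw.continuous.comp (by fun_prop : Continuous fun x : ℝ => (z, x / z))

theorem continuous_boundary : Continuous fun z => w z 1 :=
  hw.continuous.comp (by fun_prop : Continuous fun z : ℝ => (z, (1 : ℝ)))

theorem continuous_pairing : Continuous (pairing ε w) := by
  have hintegrand : Continuous fun p : ℝ × ℝ => w p.1 p.2 * trigPM ε (p.1 * p.2) :=
    hw.continuous.mul ((continuous_trigPM ε).comp continuous_mul)
  exact intervalIntegral.continuous_parametric_intervalIntegral_of_continuous'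
    (f := fun z x => w z x * trigPM ε (z * x)) hintegrand _ _

theorem scaled_eq_add_integral_kPM {z : ℝ} (hz : z ≠ 0) (x : ℝ) :
    w z (x / z) = trigPM ε x + ∫ t in (-z)..z, kPM ε 1 x t * w z (t / z) := by
  have hsubst := intervalIntegral.mul_integral_comp_mul_left (a := -1) (b := 1)
    (f := fun t => kPM ε 1 x t * w z (t / z)) z
  rw [mul_neg, mul_one] at hsubst
  rw [hw.eq_add_integral, ← hsubst, ← intervalIntegral.integral_const_mul, mul_div_cancel₀ _ hz]
  simp only [← mul_kPM_one ε z, mul_div_cancel₀ _ hz, mul_div_cancel_left₀ _ hz, mul_assoc]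

variable (hε : ε = 1 ∨ ε = -1)
include hε

theorem map_neg (z x : ℝ) : w z (-x) = ε * w z x := by
  rw [hw.eq_add_integral z (-x), hw.eq_add_integral z x, mul_neg, trigPM_neg hε, mul_add,
    ← intervalIntegral.integral_const_mul]
  simp only [kPM_neg_left hε, mul_assoc]

theorem scaled_eq_add_integral_sineKernel {z : ℝ} (hz : 0 < z) (x : ℝ) :
    w z (x / z) = trigPM ε x + ∫ t in (-z)..z, sineKernel x t * w z (t / z) := by
  rw [hw.scaled_eq_add_integral_kPM hz.ne', integral_kPM_mul hε hz.le
    (hw.continuous_scaled z).continuousOn fun t _ => by rw [neg_div, hw.map_neg hε]]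
  rfl

theorem hasDerivAt_mul_pairing {z : ℝ} (hz : z ≠ 0) :
    HasDerivAt (fun y => y * pairing ε w y) (2 * w z 1 ^ 2) z := by
  have hk : Continuous (Function.uncurry (kPM ε 1)) :=
    (continuous_kPM ε).comp (by fun_prop : Continuous fun p : ℝ × ℝ => ((1 : ℝ), p))
  have hscaled : ∀ x, ContinuousAt (Function.uncurry fun y x => w y (x / y)) (z, x) := fun x =>
    ContinuousAt.comp (f := fun p : ℝ × ℝ => (p.1, p.2 / p.1)) (x := (z, x))
      hw.continuous.continuousAt
      (continuousAt_fst.prodMk (continuousAt_snd.div continuousAt_fst hz))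
  have hderiv := hasDerivAt_integral_solution_mul hk (kPM_symm ε 1) hw.continuous_scaled
    (hscaled z) (hscaled (-z)) ((eventually_ne_nhds hz).mono fun y hy =>
      hw.scaled_eq_add_integral_kPM hy)
  have hboundary : w z (z / z) ^ 2 + w z (-z / z) ^ 2 = 2 * w z 1 ^ 2 := by
    rw [neg_div, div_self hz, hw.map_neg hε]
    rcases hε with rfl | rfl <;> ring
  rw [hboundary] at hderiv
  exact hderiv.congr_of_eventuallyEq
    ((eventually_ne_nhds hz).mono fun y hy => mul_pairing hy)

theorem integral_boundary_sq {z : ℝ} (hz : 0 ≤ z) :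
    ∫ s in (0 : ℝ)..z, 2 * w s 1 ^ 2 = z * pairing ε w z := by
  have hcont : Continuous fun s => 2 * w s 1 ^ 2 := (hw.continuous_boundary.pow 2).const_mul 2
  rw [intervalIntegral.integral_eq_sub_of_hasDerivAt_of_le hz
    (continuous_id.mul hw.continuous_pairing).continuousOn
    (fun y hy => hw.hasDerivAt_mul_pairing hε hy.1.ne') (hcont.intervalIntegrable _ _)]
  simp

end IsTrigSolution

section BoundaryValue

theorem exp_neg_I_mul_pi (x : ℝ) :
    Complex.exp (-(Complex.I * x * Real.pi)) = trigPM 1 x - trigPM (-1) x * Complex.I := by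
  have hangle : -(Complex.I * x * Real.pi) = ((-(Real.pi * x) : ℝ) : ℂ) * Complex.I := by
    push_cast
    ring
  rw [hangle, Complex.exp_mul_I, ← Complex.ofReal_cos, ← Complex.ofReal_sin, Real.cos_neg,
    Real.sin_neg, trigPM_one, trigPM_neg_one]
  push_cast
  ring

theorem intOp_sub_mul_I {L x : ℝ} {k : ℝ → ℝ → ℝ} {f g : ℝ → ℝ}
    (hf : IntervalIntegrable (fun t => k x t * f t) volume (-L) L)
    (hg : IntervalIntegrable (fun t => k x t * g t) volume (-L) L) :
    intOp L k (fun t => f t - g t * Complex.I) x =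
      (∫ t in (-L)..L, k x t * f t : ℝ) - (∫ t in (-L)..L, k x t * g t : ℝ) * Complex.I := by
  have hfc : IntervalIntegrable (fun t => ((k x t * f t : ℝ) : ℂ)) volume (-L) L :=
    ⟨hf.1.ofReal, hf.2.ofReal⟩
  have hgc : IntervalIntegrable (fun t => ((k x t * g t : ℝ) : ℂ)) volume (-L) L :=
    ⟨hg.1.ofReal, hg.2.ofReal⟩
  rw [← intervalIntegral.integral_ofReal, ← intervalIntegral.integral_ofReal,
    ← intervalIntegral.integral_mul_const,
    ← intervalIntegral.integral_sub hfc (hgc.mul_const _), intOp]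
  refine intervalIntegral.integral_congr fun t _ => ?_
  push_cast
  ring

theorem r_eq {w v : ℝ → ℝ → ℝ} (hw : IsTrigSolution 1 w) (hv : IsTrigSolution (-1) v) {s : ℝ}
    (hs : 0 < s) : r s = w s 1 + v s 1 * Complex.I := by
  let U : ℝ → ℂ := fun x => w s (x / s) - v s (x / s) * Complex.I
  have hU : Continuous U :=
    (Complex.continuous_ofReal.comp (hw.continuous_scaled s)).sub
      ((Complex.continuous_ofReal.comp (hv.continuous_scaled s)).mul_const _)
  have hint : ∀ {f : ℝ → ℝ}, Continuous f → ∀ x,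
      IntervalIntegrable (fun t => sineKernel x t * f t) volume (-s) s := fun hf x =>
    ((continuous_sineKernel.comp (by fun_prop : Continuous fun t : ℝ => (x, t))).mul
      hf).intervalIntegrable _ _
  have hUeq : ∀ x, U x = Complex.exp (-(Complex.I * x * Real.pi)) + intOp s sineKernel U x := by
    intro x
    rw [intOp_sub_mul_I (hint (hw.continuous_scaled s) x) (hint (hv.continuous_scaled s) x),
      exp_neg_I_mul_pi]
    simp only [U]
    rw [hw.scaled_eq_add_integral_sineKernel (Or.inl rfl) hs x,
      hv.scaled_eq_add_integral_sineKernel (Or.inr rfl) hs x]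
    push_cast
    ring
  have hr : U (-s) = r s := by
    rw [(isResolventKernel_Q hs).eqOn_add_intOp hs hU.continuousOn (by fun_prop)
      (fun x _ => hUeq x) (left_mem_Icc.2 (by linarith)), r]
    simp only [intOp]
    push_cast
    ring_nf
  rw [← hr]
  simp only [U, neg_div, div_self hs.ne', hw.map_neg (Or.inl rfl), hv.map_neg (Or.inr rfl)]
  push_cast
  ring

theorem norm_r_sq_add_re {ε : ℝ} (hε : ε = 1 ∨ ε = -1) {u : ℝ → ℝ → ℝ} (hu : IsTrigSolution ε u)
    {s : ℝ} (hs : 0 < s) : ‖r s ^ 2‖ + ε * (r s ^ 2).re = 2 * u s 1 ^ 2 := by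
  have hparts : ‖r s ^ 2‖ = (r s).re ^ 2 + (r s).im ^ 2 ∧
      (r s ^ 2).re = (r s).re ^ 2 - (r s).im ^ 2 := by
    constructor
    · rw [norm_pow, Complex.sq_norm, Complex.normSq_apply]
      ring
    · rw [sq, Complex.mul_re]
      ring
  rw [hparts.1, hparts.2]
  rcases hε with rfl | rfl
  · obtain ⟨v, hv⟩ := exists_isTrigSolution (Or.inr rfl)
    have hre : (r s).re = u s 1 := by simp [r_eq hu hv hs]
    rw [hre]
    ring
  · obtain ⟨w, hw⟩ := exists_isTrigSolution (Or.inl rfl)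
    have him : (r s).im = u s 1 := by simp [r_eq hw hu hs]
    rw [him]
    ring

theorem intervalIntegrable_r_sq {z : ℝ} (hz : 0 ≤ z) :
    IntervalIntegrable (fun s => r s ^ 2) volume 0 z := by
  obtain ⟨w, hw⟩ := exists_isTrigSolution (Or.inl rfl)
  obtain ⟨v, hv⟩ := exists_isTrigSolution (Or.inr rfl)
  have hcont : Continuous fun s => ((w s 1 : ℂ) + v s 1 * Complex.I) ^ 2 := by
    have := hw.continuous_boundary
    have := hv.continuous_boundary
    fun_prop
  refine (hcont.intervalIntegrable 0 z).congr fun s hs => ?_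
  rw [uIoc_of_le hz] at hs
  simp only [r_eq hw hv hs.1]

theorem integral_norm_r_sq_add_re {ε : ℝ} (hε : ε = 1 ∨ ε = -1) {u : ℝ → ℝ → ℝ}
    (hu : IsTrigSolution ε u) {z : ℝ} (hz : 0 ≤ z) :
    (∫ s in (0 : ℝ)..z, ‖r s ^ 2‖) + ε * (∫ s in (0 : ℝ)..z, r s ^ 2).re =
      z * IsTrigSolution.pairing ε u z := by
  have hint := intervalIntegrable_r_sq hz
  have hre : (∫ s in (0 : ℝ)..z, r s ^ 2).re = ∫ s in (0 : ℝ)..z, (r s ^ 2).re :=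
    (Complex.reCLM.intervalIntegral_comp_comm hint).symm
  have hint_re : IntervalIntegrable (fun s => (r s ^ 2).re) volume 0 z :=
    ⟨hint.1.re, hint.2.re⟩
  rw [← hu.integral_boundary_sq hε hz, hre, ← intervalIntegral.integral_const_mul,
    ← intervalIntegral.integral_add hint.norm (hint_re.const_mul ε)]
  exact intervalIntegral.integral_congr_Ioo_of_le hz fun s hs => norm_r_sq_add_re hε hu hs.1

end BoundaryValue

section Determinant

theorem eq_mul_exp_neg_integral {f p : ℝ → ℝ} (hp : Continuous p)
    (hf : ∀ z, HasDerivAt f (-(p z * f z)) z) (a z : ℝ) :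
    f z = f a * Real.exp (-∫ s in a..z, p s) := by
  have hconst : ∀ z, HasDerivAt (fun z => f z * Real.exp (∫ s in a..z, p s)) 0 z := fun z => by
    have hexp := (intervalIntegral.integral_hasDerivAt_right (hp.intervalIntegrable a z)
      (hp.stronglyMeasurableAtFilter _ _) hp.continuousAt).exp
    convert! (hf z).mul hexp using 1
    ring
  have hza := is_const_of_deriv_eq_zero (fun z => (hconst z).differentiableAt)
    (fun z => (hconst z).deriv) z a
  simp only [intervalIntegral.integral_same, Real.exp_zero, mul_one] at hza
  rw [← hza, mul_assoc, ← Real.exp_add, add_neg_cancel, Real.exp_zero, mul_one]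

theorem fredholmTerm_one (k : ℝ → ℝ → ℝ) (a b : ℝ) (n : ℕ) :
    fredholmTerm k a b 1 n =
      fredholmWeight n * fredholmCoeff (volume.restrict (Icc a b)) k n := by
  rw [fredholmTerm, fredholmWeight, fredholmCoeff, volume_pi, Measure.restrict_pi_pi]
  rfl

theorem P_one (ε z : ℝ) : P ε z 1 = fredholmSum (volume.restrict (Icc (-1) 1)) (kPM ε z) := by
  simp only [P, fredholmDet, fredholmTerm_one, fredholmSum]

theorem P_zero_one (ε : ℝ) : P ε 0 1 = 1 := by
  have hkernel : ∀ {n : ℕ} (y : Fin n → ℝ), kernelMatrix (kPM ε 0) y = 0 := fun y => by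
    ext i j
    simp [kernelMatrix, kPM, sineFun]
  have hterm : ∀ n, n ≠ 0 → fredholmWeight n *
      fredholmCoeff (volume.restrict (Icc (-1) 1)) (kPM ε 0) n = 0 := fun n hn => by
    have : Nonempty (Fin n) := ⟨⟨0, Nat.pos_of_ne_zero hn⟩⟩
    simp [fredholmCoeff, hkernel, Matrix.det_zero]
  rw [P_one, fredholmSum, tsum_eq_single 0 hterm, fredholmWeight_zero, fredholmCoeff_zero, one_mul]

variable {ε : ℝ} (hε : ε = 1 ∨ ε = -1)
include hε

theorem summable_fredholmTerm_kPM (z : ℝ) : Summable (fredholmTerm (kPM ε z) (-1) 1 1) := by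
  simpa only [← fredholmTerm_one] using
    summable_fredholmSeries (volume.restrict (Icc (-1) 1)) (abs_kPM_le hε z)

variable {w : ℝ → ℝ → ℝ} (hw : IsTrigSolution ε w)
include hw

theorem hasDerivAt_P (z : ℝ) :
    HasDerivAt (fun z => P ε z 1) (-(IsTrigSolution.pairing ε w z * P ε z 1)) z := by
  have hIcc : ∀ f : ℝ → ℝ, ∫ x in (-1 : ℝ)..1, f x = ∫ x in Icc (-1 : ℝ) 1, f x := fun f => by
    rw [intervalIntegral.integral_of_le (by norm_num), integral_Icc_eq_integral_Ioc]
  have hk : ∀ y, Measurable (Function.uncurry (kPM ε y)) := fun y =>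
    ((continuous_kPM ε).comp (by fun_prop : Continuous fun p : ℝ × ℝ => (y, p))).measurable
  have htrig : ∀ y, Measurable fun x => trigPM ε (y * x) := fun y =>
    ((continuous_trigPM ε).comp (by fun_prop : Continuous fun x : ℝ => y * x)).measurable
  have hkM : ∀ y ∈ Metric.ball z 1, ∀ x t, |kPM ε y x t| ≤ |z| + 1 := fun y hy x t => by
    rw [Metric.mem_ball, Real.dist_eq] at hy
    linarith [abs_kPM_le hε y x t, abs_sub_abs_le_abs_sub y z]
  have htrigM : ∀ y ∈ Metric.ball z 1, ∀ x, |trigPM ε (y * x)| ≤ |z| + 1 := fun y _ x => by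
    linarith [abs_trigPM_le hε (y * x), abs_nonneg z]
  have hwz : Continuous (w z) := hw.continuous.comp (Continuous.prodMk_right z)
  have hderiv := hasDerivAt_fredholmSum (volume.restrict (Icc (-1 : ℝ) 1)) hk htrig htrig
    Metric.isOpen_ball hkM htrigM htrigM (convex_ball z 1).isPreconnected
    (fun y _ => hasDerivAt_kPM hε y) (Metric.mem_ball_self one_pos)
    (hwz.continuousOn.integrableOn_compact isCompact_Icc)
    fun x => (hw.eq_add_integral z x).trans (by rw [hIcc])
  simpa only [IsTrigSolution.pairing, ← P_one, ← hIcc] using hderiv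

theorem P_one_eq_exp (z : ℝ) :
    P ε z 1 = Real.exp (-∫ s in (0 : ℝ)..z, IsTrigSolution.pairing ε w s) := by
  simpa only [P_zero_one, one_mul] using
    eq_mul_exp_neg_integral hw.continuous_pairing (hasDerivAt_P hε hw) 0 z

theorem hasDerivAt_log_P (z : ℝ) :
    HasDerivAt (fun z => Real.log (P ε z 1)) (-IsTrigSolution.pairing ε w z) z := by
  have hp := hw.continuous_pairing
  simp only [P_one_eq_exp hε hw, Real.log_exp]
  exact (intervalIntegral.integral_hasDerivAt_right (hp.intervalIntegrable 0 z)
    (hp.stronglyMeasurableAtFilter _ _) hp.continuousAt).neg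

end Determinant

end SineDet

end

theorem theorem4p5 :
    ∀ ζ : ℝ, 0 < ζ →
      SineDet.IsResolventKernel ζ SineDet.sineKernel (SineDet.Q ζ) ∧
      IntervalIntegrable (fun s : ℝ => SineDet.r s ^ 2) volume 0 ζ ∧
      ∀ ε : ℝ, ε = 1 ∨ ε = -1 →
        Summable (SineDet.fredholmTerm (SineDet.kPM ε ζ) (-1) 1 1) ∧
        0 < SineDet.P ε ζ 1 ∧
        DifferentiableAt ℝ (fun z : ℝ => Real.log (SineDet.P ε z 1)) ζ ∧
        ζ * deriv (fun z : ℝ => Real.log (SineDet.P ε z 1)) ζ =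
          -((∫ s in (0 : ℝ)..ζ, ‖SineDet.r s ^ 2‖) +
            ε * (∫ s in (0 : ℝ)..ζ, SineDet.r s ^ 2).re) := by
  intro ζ hζ
  refine ⟨SineDet.isResolventKernel_Q hζ, SineDet.intervalIntegrable_r_sq hζ.le, fun ε hε => ?_⟩
  obtain ⟨u, hu⟩ := SineDet.exists_isTrigSolution hε
  have hlog := SineDet.hasDerivAt_log_P hε hu ζ
  have hpos : 0 < SineDet.P ε ζ 1 := by
    rw [SineDet.P_one_eq_exp hε hu]
    exact Real.exp_pos _
  refine ⟨SineDet.summable_fredholmTerm_kPM hε ζ, hpos, hlog.differentiableAt, ?_⟩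
  rw [hlog.deriv, mul_neg, SineDet.integral_norm_r_sq_add_re hε hu hζ.le]
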